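/- Let $k$ be an algebraically closed field and $\mathcal{C}$ a $k$-linear triangulated category with suspension functor $\Sigma$ in which idempotents split. Assume that $\mathcal{C}$ is Hom-finite (all spaces $\mathcal{C}(X,Y)$ are finite-dimensional over $k$) and 2-Calabi-Yau, i.e. there are bifunctorial isomorphisms $\mathrm{Hom}_k(\mathcal{C}(X,Y),k)\simeq\mathcal{C}(Y,\Sigma^2X)$, and that $T$ is a cluster-tilting object of $\mathcal{C}$, i.e. $T$ is rigid ($\mathcal{C}(T,\Sigma T)=0$) and basic (its indecomposable direct summands are pairwise non-isomorphic), and every object $X$ with $\mathcal{C}(T,\Sigma X)=0$ lies in $\mathrm{add}\,T$, the subcategory of direct summands of finite direct sums of copies of $T$. Suppose that $\mathcal{C}$ has only finitely many isomorphism classes of indecomposable objects, and let $T_0,T_1$ be objects of $\mathrm{add}\,T$ without a nonzero direct summand in common. For $\eta\in\mathcal{C}(T_1,T_0)$ let $C(\eta)$ be its cone, given by a triangle $T_1\xrightarrow{\eta}T_0\to C(\eta)\to\Sigma T_1$. Then there exists a morphism $\eta\in\mathcal{C}(T_1,T_0)$ whose cone is rigid, i.e. $\mathcal{C}(C(\eta),\Sigma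 C(\eta))=0$. Moreover, for the action $(g_0,g_1)\eta=g_0\,\eta\,g_1^{-1}$ of $\mathrm{Aut}(T_0)\times\mathrm{Aut}(T_1)$ on the affine space $\mathcal{C}(T_1,T_0)$, there are only finitely many orbits, and for every $\eta\in\mathcal{C}(T_1,T_0)$ the codimension of (the Zariski closure of) the orbit $\mathcal{O}_\eta$ of $\eta$ in $\mathcal{C}(T_1,T_0)$ is $$\mathrm{codim}\,\mathcal{O}_\eta=\tfrac12\dim_k\mathrm{Ext}^1_{\mathcal{C}}(C(\eta),C(\eta))=\tfrac12\dim_k\mathcal{C}(C(\eta),\Sigma C(\eta)).$$ -/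

import Mathlib

open CategoryTheory CategoryTheory.Limits CategoryTheory.Pretriangulated

namespace TwoCY

universe u v w

section Linear

variable (k : Type u) [Field k] (C : Type v) [Category.{w} C] [Preadditive C] [Linear k C]
  [HasShift C ℤ]

/-- `C` is 2-Calabi-Yau over `k`: there are `k`-linear isomorphisms
`D C(X, Y) ≃ C(Y, Σ² X)`, natural in `X` and in `Y`, where `D` is the `k`-linear dual. -/
def IsTwoCalabiYau : Prop :=
  ∃ e : ∀ X Y : C, Module.Dual k (X ⟶ Y) ≃ₗ[k] (Y ⟶ X⟦(2 : ℤ)⟧),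
    (∀ (X X' Y : C) (a : X ⟶ X') (φ : Module.Dual k (X ⟶ Y)),
      e X' Y (φ.comp (Linear.leftComp k Y a)) = e X Y φ ≫ a⟦(2 : ℤ)⟧') ∧
    (∀ (X Y Y' : C) (b : Y ⟶ Y') (φ : Module.Dual k (X ⟶ Y')),
      e X Y (φ.comp (Linear.rightComp k X b)) = b ≫ e X Y' φ)

end Linear

section Triangulated

variable {C : Type v} [Category.{w} C] [Preadditive C] [HasZeroObject C] [HasShift C ℤ]
  [∀ n : ℤ, (shiftFunctor C n).Additive] [Pretriangulated C]

/-- `Y` is a direct summand of `X`. -/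
def IsDirectSummand (Y X : C) : Prop :=
  ∃ Z : C, Nonempty (X ≅ Y ⊞ Z)

/-- `X` lies in `add T`: it is a direct summand of a finite direct sum of copies of `T`. -/
def InAdd (T X : C) : Prop :=
  ∃ n : ℕ, IsDirectSummand X (⨁ fun _ : Fin n => T)

/-- `X` is rigid: `C(X, Σ X) = 0`. -/
def IsRigid (X : C) : Prop :=
  ∀ f : X ⟶ X⟦(1 : ℤ)⟧, f = 0

/-- `X` is basic: whenever `X` is written as a finite direct sum of indecomposable objects,
these are pairwise non-isomorphic. -/
def IsBasic (X : C) : Prop :=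
  ∀ (n : ℕ) (U : Fin n → C), (∀ i, Indecomposable (U i)) → Nonempty (X ≅ ⨁ U) →
    ∀ i j : Fin n, i ≠ j → ¬ Nonempty (U i ≅ U j)

/-- `T` is a (basic) cluster-tilting object. -/
structure IsClusterTilting (T : C) : Prop where
  rigid : IsRigid T
  basic : IsBasic T
  mem_add : ∀ X : C, (∀ f : T ⟶ X⟦(1 : ℤ)⟧, f = 0) → InAdd T X

/-- `X` and `Y` have no nonzero direct summand in common (up to isomorphism). -/
def NoCommonSummand (X Y : C) : Prop :=
  ∀ Z : C, IsDirectSummand Z X → IsDirectSummand Z Y → IsZero Z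

variable (C) in
/-- Up to isomorphism, `C` has only finitely many indecomposable objects. -/
def FinitelyManyIndecomposables : Prop :=
  ∃ (n : ℕ) (U : Fin n → C), ∀ X : C, Indecomposable X → ∃ i, Nonempty (X ≅ U i)

/-- `Z` is a cone of `η : X ⟶ Y`: there is a distinguished triangle
`X ⟶ Y ⟶ Z ⟶ Σ X` whose first morphism is `η`. It exists and is unique up to isomorphism. -/
def IsCone {X Y : C} (η : X ⟶ Y) (Z : C) : Prop :=
  ∃ (ι : Y ⟶ Z) (p : Z ⟶ X⟦(1 : ℤ)⟧), Triangle.mk η ι p ∈ distTriang C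

end Triangulated

/-- The orbit of `η` under the action `(g₀, g₁) • η = g₀ η g₁⁻¹` of `Aut Y × Aut X`
on `C(X, Y)`. -/
def autOrbit {C : Type v} [Category.{w} C] {X Y : C} (η : X ⟶ Y) : Set (X ⟶ Y) :=
  {η' | ∃ (g₀ : Aut Y) (g₁ : Aut X), η' = g₁.inv ≫ η ≫ g₀.hom}

/-- The codimension of (the Zariski closure of) a subset `S` of a finite-dimensional vector space
`V`, viewed as an affine space: the height of the ideal of all polynomials in the coordinates of
some basis of `V` that vanish on `S`. -/
noncomputable def zariskiCodim (k : Type u) [Field k] {V : Type w} [AddCommGroup V] [Module k V]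
    [Module.Finite k V] (S : Set V) : ℕ∞ :=
  (MvPolynomial.vanishingIdeal k ((Module.finBasis k V).equivFun '' S)).height

end TwoCY

/-!
Put `V = C(T₁, T₀)` and let `Z` be the cone of `η`, with triangle `T₁ ⟶ T₀ ⟶ Z ⟶ Σ T₁`.

*Codimension.* The stabilizer of `η` is open in the linear space of pairs `(a, b)` with `a η = η b`,
so the dimension of the orbit is the rank of the tangent map `(a, b) ↦ a η - η b`, in every
characteristic. Since `zariskiCodim` is the height of a prime in a polynomial ring, this is proved
without dimension theory (`height_unitOrbit`): a birational self-map of `V` with birational inverse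
carries the image `R` of the tangent map onto a dense subset of the orbit, and the images of a
complete flag of subspaces through `R` give a chain of primes of length `dim V` passing through the
vanishing ideal of the orbit (`height_vanishing_flagImage`). As the polynomial ring has dimension
`dim V`, the height of that ideal is `dim V - dim R`.

*Calabi-Yau duality.* Composition with the maps of the triangle gives `C(Σ T₁, Σ T₀) ⟶ C(Z, Σ Z)`,
whose kernel is `Σ R` (`ker_throughShift`), and `C(Z, Σ Z) ⟶ C(T₀, Σ² T₁)`; the image of the first
is the kernel of the second (`range_throughShift`) because `T` is rigid. The 2-Calabi-Yau
isomorphisms make the second map the transpose of the first, so both have the same rank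
`dim V - dim R`, and `dim C(Z, Σ Z)` is twice that (`finrank_cone_hom_shift`).

*Finitely many orbits.* As `T₀` and `T₁` have no common summand, `η` is radical, so `T₀ ⟶ Z` is a
minimal right approximation and the cone determines the orbit (`autOrbit_eq_of_iso`). The number
`dim C(T, X) + dim C(T, Σ X)` is positive for `X ≠ 0`, superadditive, and bounded on cones of
morphisms in `V`. Hence the number of indecomposable summands of such cones is bounded, and only
finitely many isomorphism classes of cones occur.

*Rigid cone.* The finitely many orbits cover `V`, so one of them is dense
(`exists_zariskiCodim_eq_zero`). It has codimension `0`, so its cone `Z` has `C(Z, Σ Z) = 0`.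
-/

namespace TwoCY

/-! ### Polynomial functions and maps on vector spaces -/

section PolynomialFunctions

variable (k : Type*) [Field k]

/-- The `k`-algebra of polynomial functions on a vector space `E`: the subalgebra of all functions
`E → k` generated by the linear forms. -/
def polyFun (E : Type*) [AddCommGroup E] [Module k E] : Subalgebra k (E → k) :=
  Algebra.adjoin k (Set.range fun φ : Module.Dual k E => (φ : E → k))

variable {k} {E F V : Type*} [AddCommGroup E] [Module k E] [AddCommGroup F] [Module k F]
  [AddCommGroup V] [Module k V]

/-- A map between vector spaces is polynomial if its composites with all linear forms are
polynomial functions. -/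
def IsPolyMap (k : Type*) [Field k] {E V : Type*} [AddCommGroup E] [Module k E] [AddCommGroup V]
    [Module k V] (u : E → V) : Prop :=
  ∀ φ : Module.Dual k V, (fun x => φ (u x)) ∈ polyFun k E

theorem dual_mem_polyFun (φ : Module.Dual k E) : (φ : E → k) ∈ polyFun k E :=
  Algebra.subset_adjoin ⟨φ, rfl⟩

theorem const_mem_polyFun (c : k) : (fun _ => c) ∈ polyFun k E :=
  (polyFun k E).algebraMap_mem c

theorem polyFun_comp {f : V → k} (hf : f ∈ polyFun k V) {u : E → V} (hu : IsPolyMap k u) :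
    (fun x => f (u x)) ∈ polyFun k E := by
  induction hf using Algebra.adjoin_induction with
  | mem f hf => obtain ⟨φ, rfl⟩ := hf; exact hu φ
  | algebraMap c => exact const_mem_polyFun c
  | add f g _ _ hf hg => exact (polyFun k E).add_mem hf hg
  | mul f g _ _ hf hg => exact (polyFun k E).mul_mem hf hg

theorem mul_mem_polyFun {f g : E → k} (hf : f ∈ polyFun k E) (hg : g ∈ polyFun k E) :
    (fun x => f x * g x) ∈ polyFun k E :=
  (polyFun k E).mul_mem hf hg

theorem sum_mem_polyFun {ι : Type*} (s : Finset ι) {f : ι → E → k}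
    (hf : ∀ i ∈ s, f i ∈ polyFun k E) : (fun x => ∑ i ∈ s, f i x) ∈ polyFun k E := by
  have := (polyFun k E).sum_mem hf
  convert this using 1
  ext x
  simp

theorem prod_mem_polyFun {ι : Type*} (s : Finset ι) {f : ι → E → k}
    (hf : ∀ i ∈ s, f i ∈ polyFun k E) : (fun x => ∏ i ∈ s, f i x) ∈ polyFun k E := by
  have := (polyFun k E).prod_mem hf
  convert this using 1
  ext x
  simp

namespace IsPolyMap

theorem linear (u : E →ₗ[k] V) : IsPolyMap k u := fun φ => dual_mem_polyFun (φ ∘ₗ u)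

theorem const (v : V) : IsPolyMap k (fun _ : E => v) := fun φ => const_mem_polyFun (φ v)

theorem add {u v : E → V} (hu : IsPolyMap k u) (hv : IsPolyMap k v) :
    IsPolyMap k (fun x => u x + v x) := fun φ => by
  simp only [map_add]
  exact (polyFun k E).add_mem (hu φ) (hv φ)

theorem sub {u v : E → V} (hu : IsPolyMap k u) (hv : IsPolyMap k v) :
    IsPolyMap k (fun x => u x - v x) := fun φ => by
  simp only [map_sub]
  exact (polyFun k E).sub_mem (hu φ) (hv φ)

theorem smul {f : E → k} {u : E → V} (hf : f ∈ polyFun k E) (hu : IsPolyMap k u) :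
    IsPolyMap k (fun x => f x • u x) := fun φ => by
  simp only [map_smul, smul_eq_mul]
  exact mul_mem_polyFun hf (hu φ)

theorem comp {u : F → V} {v : E → F} (hu : IsPolyMap k u) (hv : IsPolyMap k v) :
    IsPolyMap k (fun x => u (v x)) := fun φ => polyFun_comp (hu φ) hv

theorem sum {ι : Type*} (s : Finset ι) {u : ι → E → V} (hu : ∀ i ∈ s, IsPolyMap k (u i)) :
    IsPolyMap k (fun x => ∑ i ∈ s, u i x) := fun φ => by
  simp only [map_sum]
  exact sum_mem_polyFun s fun i hi => hu i hi φ

theorem bilin {W : Type*} [AddCommGroup W] [Module k W] [Module.Finite k F]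
    (B : F →ₗ[k] V →ₗ[k] W) {u : E → F} {v : E → V} (hu : IsPolyMap k u) (hv : IsPolyMap k v) :
    IsPolyMap k (fun x => B (u x) (v x)) := by
  let b := Module.finBasis k F
  have h : ∀ x, B (u x) (v x) = ∑ i, b.coord i (u x) • B (b i) (v x) := fun x => by
    conv_lhs => rw [← b.sum_repr (u x), map_sum, LinearMap.sum_apply]
    simp
  simp only [h]
  exact sum _ fun i _ => smul (hu (b.coord i)) ((linear (B (b i))).comp hv)

/-- A linear endomorphism depending polynomially on a parameter, applied to a vector depending
polynomially on the parameter. -/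
theorem apply [Module.Finite k V] {u : E → V →ₗ[k] V} {v : E → V} (hu : IsPolyMap k u)
    (hv : IsPolyMap k v) : IsPolyMap k (fun x => u x (v x)) :=
  bilin (LinearMap.id : (V →ₗ[k] V) →ₗ[k] (V →ₗ[k] V)) hu hv

theorem toMatrix_entry {ι : Type*} [Fintype ι] [DecidableEq ι] (b : Module.Basis ι k V)
    {u : E → V →ₗ[k] V} (hu : IsPolyMap k u) (i j : ι) :
    (fun x => LinearMap.toMatrix b b (u x) i j) ∈ polyFun k E := by
  have := hu ((b.coord i) ∘ₗ (LinearMap.applyₗ (b j)))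
  simpa [LinearMap.toMatrix_apply] using this

end IsPolyMap

theorem matrix_det_mem_polyFun {ι : Type*} [Fintype ι] [DecidableEq ι] {M : E → Matrix ι ι k}
    (hM : ∀ i j, (fun x => M x i j) ∈ polyFun k E) : (fun x => (M x).det) ∈ polyFun k E := by
  simp only [Matrix.det_apply]
  refine sum_mem_polyFun _ fun σ _ => ?_
  exact (polyFun k E).zsmul_mem (prod_mem_polyFun _ fun i _ => hM _ _)
    ((Equiv.Perm.sign σ : ℤˣ) : ℤ)

theorem det_mem_polyFun [Module.Finite k V] {u : E → V →ₗ[k] V} (hu : IsPolyMap k u) :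
    (fun x => LinearMap.det (u x)) ∈ polyFun k E := by
  let b := Module.finBasis k V
  simp only [← LinearMap.det_toMatrix b]
  exact matrix_det_mem_polyFun fun i j => hu.toMatrix_entry b i j

/-- The adjugate of a polynomial family of endomorphisms is again a polynomial family. -/
theorem exists_adjugate [Module.Finite k V] {u : E → V →ₗ[k] V} (hu : IsPolyMap k u) :
    ∃ a : E → V →ₗ[k] V, IsPolyMap k a ∧
      (∀ x v, a x (u x v) = LinearMap.det (u x) • v) ∧
      ∀ x v, u x (a x v) = LinearMap.det (u x) • v := by
  classical
  let b := Module.finBasis k V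
  let U := fun x => LinearMap.toMatrix b b (u x)
  have hU : ∀ x, u x = Matrix.toLin b b (U x) := fun x => (Matrix.toLin_toMatrix b b _).symm
  refine ⟨fun x => Matrix.toLin b b (U x).adjugate, ?_, fun x v => ?_, fun x v => ?_⟩
  · have h : ∀ x, Matrix.toLin b b (U x).adjugate =
        ∑ i, ∑ j, (U x).adjugate i j • Matrix.toLin b b (Matrix.single i j 1) := fun x => by
      conv_lhs => rw [Matrix.matrix_eq_sum_single (U x).adjugate]
      simp only [map_sum, ← map_smul, Matrix.smul_single, smul_eq_mul, mul_one]
    simp only [h]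
    refine IsPolyMap.sum _ fun i _ => IsPolyMap.sum _ fun j _ => IsPolyMap.smul ?_ (.const _)
    simp only [Matrix.adjugate_apply]
    refine matrix_det_mem_polyFun fun i' j' => ?_
    simp only [Matrix.updateRow_apply]
    split_ifs
    · exact const_mem_polyFun _
    · exact hu.toMatrix_entry b i' j'
  · have : LinearMap.det (u x) = (U x).det := (LinearMap.det_toMatrix b _).symm
    rw [this, hU x, ← Matrix.toLin_mul_apply, Matrix.adjugate_mul]
    simp
  · have : LinearMap.det (u x) = (U x).det := (LinearMap.det_toMatrix b _).symm
    rw [this, hU x, ← Matrix.toLin_mul_apply, Matrix.mul_adjugate]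
    simp

/-- Clearing denominators: after multiplication by a power of `d`, the composite of a polynomial
function with the rational map `d⁻¹ u` is a polynomial function. -/
theorem exists_clear_denom {f : V → k} (hf : f ∈ polyFun k V) {u : E → V} (hu : IsPolyMap k u)
    {d : E → k} (hd : d ∈ polyFun k E) :
    ∃ (M : ℕ) (g : E → k), g ∈ polyFun k E ∧
      ∀ x, d x ≠ 0 → g x = d x ^ M * f ((d x)⁻¹ • u x) := by
  have hpow : ∀ M : ℕ, (fun x => d x ^ M) ∈ polyFun k E := fun M => (polyFun k E).pow_mem hd M
  induction hf using Algebra.adjoin_induction with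
  | mem f hf =>
    obtain ⟨φ, rfl⟩ := hf
    refine ⟨1, _, hu φ, fun x hx => ?_⟩
    simp [hx]
  | algebraMap c => exact ⟨0, _, const_mem_polyFun c, fun x hx => by simp⟩
  | add f g _ _ hf hg =>
    obtain ⟨M, F, hF, hF'⟩ := hf
    obtain ⟨N, G, hG, hG'⟩ := hg
    refine ⟨M + N, _, (polyFun k E).add_mem (mul_mem_polyFun (hpow N) hF)
      (mul_mem_polyFun (hpow M) hG), fun x hx => ?_⟩
    simp only [Pi.add_apply, hF' x hx, hG' x hx]
    ring
  | mul f g _ _ hf hg =>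
    obtain ⟨M, F, hF, hF'⟩ := hf
    obtain ⟨N, G, hG, hG'⟩ := hg
    refine ⟨M + N, _, mul_mem_polyFun hF hG, fun x hx => ?_⟩
    simp only [Pi.mul_apply, hF' x hx, hG' x hx]
    ring

variable [Module.Finite k V]

theorem eval_mem_polyFun (p : MvPolynomial (Fin (Module.finrank k V)) k) :
    (fun v => MvPolynomial.aeval ((Module.finBasis k V).equivFun v) p) ∈ polyFun k V := by
  induction p using MvPolynomial.induction_on with
  | C c => simpa using const_mem_polyFun c
  | add p q hp hq => simp only [map_add]; exact (polyFun k V).add_mem hp hq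
  | mul_X p i hp =>
    simp only [map_mul, MvPolynomial.aeval_X]
    exact mul_mem_polyFun hp (dual_mem_polyFun ((Module.finBasis k V).coord i))

theorem exists_eval_eq {f : V → k} (hf : f ∈ polyFun k V) :
    ∃ p : MvPolynomial (Fin (Module.finrank k V)) k,
      ∀ v, MvPolynomial.aeval ((Module.finBasis k V).equivFun v) p = f v := by
  let b := Module.finBasis k V
  induction hf using Algebra.adjoin_induction with
  | mem f hf =>
    obtain ⟨φ, rfl⟩ := hf
    refine ⟨∑ i, MvPolynomial.C (φ (b i)) * MvPolynomial.X i, fun v => ?_⟩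
    change _ = φ v
    conv_rhs => rw [← b.sum_repr v, map_sum]
    simp [b, mul_comm]
  | algebraMap c => exact ⟨MvPolynomial.C c, fun v => by simp⟩
  | add f g _ _ hf hg =>
    obtain ⟨p, hp⟩ := hf
    obtain ⟨q, hq⟩ := hg
    exact ⟨p + q, fun v => by rw [map_add, hp, hq]; rfl⟩
  | mul f g _ _ hf hg =>
    obtain ⟨p, hp⟩ := hf
    obtain ⟨q, hq⟩ := hg
    exact ⟨p * q, fun v => by rw [map_mul, hp, hq]; rfl⟩

/-- Nonempty Zariski-open subsets of a vector space over an infinite field meet. -/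
theorem exists_mul_ne_zero [Infinite k] {f g : V → k} (hf : f ∈ polyFun k V)
    (hg : g ∈ polyFun k V) {x y : V} (hx : f x ≠ 0) (hy : g y ≠ 0) :
    ∃ z, f z ≠ 0 ∧ g z ≠ 0 := by
  obtain ⟨p, hp⟩ := exists_eval_eq hf
  obtain ⟨q, hq⟩ := exists_eval_eq hg
  by_contra! h
  have hpq : p * q = 0 := MvPolynomial.funext fun t => by
    have h1 := hp ((Module.finBasis k V).equivFun.symm t)
    have h2 := hq ((Module.finBasis k V).equivFun.symm t)
    simp only [LinearEquiv.apply_symm_apply] at h1 h2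
    have h3 := h ((Module.finBasis k V).equivFun.symm t)
    rw [← MvPolynomial.coe_aeval_eq_eval]
    simp only [RingHom.coe_coe, map_mul, map_zero, mul_eq_zero, h1, h2]
    tauto
  rcases mul_eq_zero.mp hpq with h0 | h0
  · exact hx (by rw [← hp, h0, map_zero])
  · exact hy (by rw [← hq, h0, map_zero])

end PolynomialFunctions

/-! ### Vanishing ideals of images of rational maps -/

section VanishingIdeals

variable {k : Type*} [Field k] {E V : Type*} [AddCommGroup E] [Module k E]
  [AddCommGroup V] [Module k V] [Module.Finite k V]

variable (k) in
/-- The ideal of all polynomials, in the coordinates of the chosen basis of `V`, that vanish on a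
subset of `V`; its height is `zariskiCodim`. -/
noncomputable def vanishing (S : Set V) : Ideal (MvPolynomial (Fin (Module.finrank k V)) k) :=
  MvPolynomial.vanishingIdeal k ((Module.finBasis k V).equivFun '' S)

theorem mem_vanishing {S : Set V} {p : MvPolynomial (Fin (Module.finrank k V)) k} :
    p ∈ vanishing k S ↔
      ∀ v ∈ S, MvPolynomial.aeval ((Module.finBasis k V).equivFun v) p = 0 := by
  simp [vanishing, MvPolynomial.mem_vanishingIdeal_iff]

theorem vanishing_anti {S S' : Set V} (h : S ⊆ S') : vanishing k S' ≤ vanishing k S :=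
  fun _ hp => mem_vanishing.mpr fun v hv => mem_vanishing.mp hp v (h hv)

/-- Every subspace is spanned by an initial segment of a basis. -/
theorem exists_adapted_basis (R : Submodule k V) :
    ∃ c : Module.Basis (Fin (Module.finrank k V)) k V,
      ∀ x, (∀ j : Fin (Module.finrank k V), Module.finrank k R ≤ j → c.coord j x = 0) ↔ x ∈ R := by
  obtain ⟨R', h⟩ := R.exists_isCompl
  have hn : Module.finrank k R + Module.finrank k R' = Module.finrank k V :=
    Submodule.finrank_add_eq_of_isCompl h
  let e := Submodule.prodEquivOfIsCompl R R' h
  let c := ((((Module.finBasis k R).prod (Module.finBasis k R')).map e).reindex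
    finSumFinEquiv).reindex (finCongr hn)
  have hc : ∀ (j : Fin (Module.finrank k R')) x,
      c.coord (finCongr hn (Fin.natAdd _ j)) x =
        (Module.finBasis k R').coord j (e.symm x).2 := fun j x => by
    simp [c]
  have hR : ∀ x, (e.symm x).2 = 0 ↔ x ∈ R := fun x =>
    Submodule.prodEquivOfIsCompl_symm_apply_snd_eq_zero _ _ h
  refine ⟨c, fun x => ?_⟩
  rw [← hR x]
  constructor
  · intro h0
    refine (Module.finBasis k R').ext_elem fun j => ?_
    have := h0 (finCongr hn (Fin.natAdd _ j)) (by simp)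
    rw [hc] at this
    simpa using this
  · intro h0 j hj
    obtain ⟨j', rfl⟩ : ∃ j', j = finCongr hn (Fin.natAdd _ j') :=
      ⟨⟨j - Module.finrank k R, by have := j.2; omega⟩, by ext; simp; omega⟩
    rw [hc, h0, map_zero]

/-- The image of a rational map defined on a nonempty open subset of a vector space is
irreducible. -/
theorem isPrime_vanishing_rational [Infinite k] [Module.Finite k E] {D : E → k} {u : E → V}
    (hD : D ∈ polyFun k E) (hu : IsPolyMap k u) {x₀ : E} (hx₀ : D x₀ ≠ 0) :
    (vanishing k {v | ∃ x, D x ≠ 0 ∧ v = (D x)⁻¹ • u x}).IsPrime := by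
  refine ⟨fun h => ?_, fun {p q} hpq => ?_⟩
  · have := mem_vanishing.mp ((Ideal.eq_top_iff_one _).mp h) _ ⟨x₀, hx₀, rfl⟩
    simp at this
  · by_contra! h
    simp only [mem_vanishing, not_forall] at h
    obtain ⟨⟨_, ⟨x, hx, rfl⟩, hpx⟩, ⟨_, ⟨y, hy, rfl⟩, hqy⟩⟩ := h
    obtain ⟨M, F, hF, hF'⟩ := exists_clear_denom (eval_mem_polyFun p) hu hD
    obtain ⟨N, G, hG, hG'⟩ := exists_clear_denom (eval_mem_polyFun q) hu hD
    obtain ⟨z, hz, hz'⟩ := exists_mul_ne_zero (mul_mem_polyFun hD hF) (mul_mem_polyFun hD hG)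
      (x := x) (y := y)
      (mul_ne_zero hx (by rw [hF' x hx]; exact mul_ne_zero (pow_ne_zero _ hx) hpx))
      (mul_ne_zero hy (by rw [hG' y hy]; exact mul_ne_zero (pow_ne_zero _ hy) hqy))
    have hDz := left_ne_zero_of_mul hz
    have h1 := right_ne_zero_of_mul hz
    have h2 := right_ne_zero_of_mul hz'
    rw [hF' z hDz] at h1
    rw [hG' z hDz] at h2
    have := mem_vanishing.mp hpq _ ⟨z, hDz, rfl⟩
    rw [map_mul] at this
    exact mul_ne_zero (right_ne_zero_of_mul h1) (right_ne_zero_of_mul h2) this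

/-- The image of the first `i` coordinate directions of `V` under the rational map `D⁻¹ u`. -/
def flagImage {n : ℕ} (c : Module.Basis (Fin n) k V) (D : V → k) (u : V → V) (i : ℕ) : Set V :=
  {v | ∃ x, (∀ j : Fin n, i ≤ j → c.coord j x = 0) ∧ D x ≠ 0 ∧ v = (D x)⁻¹ • u x}

variable [Infinite k] {n : ℕ} (c : Module.Basis (Fin n) k V) {D δ : V → k} {u ξ : V → V}

theorem isPrime_vanishing_flagImage (hD : D ∈ polyFun k V) (hu : IsPolyMap k u) (hD₀ : D 0 ≠ 0)
    (i : ℕ) : (vanishing k (flagImage c D u i)).IsPrime := by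
  let Y : Submodule k V := ⨅ j : Fin n, ⨅ _ : i ≤ j, LinearMap.ker (c.coord j)
  have hY : ∀ x, x ∈ Y ↔ ∀ j : Fin n, i ≤ j → c.coord j x = 0 := fun x => by
    simp [Y, Submodule.mem_iInf]
  have h := isPrime_vanishing_rational (E := Y) (D := fun x => D x) (u := fun x => u x)
    (polyFun_comp hD (.linear Y.subtype)) (hu.comp (.linear Y.subtype)) (x₀ := 0) hD₀
  convert h using 3
  ext v
  constructor
  · rintro ⟨x, hx, hx'⟩
    exact ⟨⟨x, (hY x).mpr hx⟩, hx'⟩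
  · rintro ⟨x, hx'⟩
    exact ⟨x, (hY x).mp x.2, hx'⟩

/-- Each step of the flag enlarges the closure of its image: the `i`-th coordinate of the rational
inverse vanishes on the smaller image and not on the larger one. -/
theorem vanishing_flagImage_lt (hD : D ∈ polyFun k V) (hδ : δ ∈ polyFun k V)
    (hu : IsPolyMap k u) (hξ : IsPolyMap k ξ) (hD₀ : D 0 ≠ 0) (hδ₀ : δ ((D 0)⁻¹ • u 0) ≠ 0)
    (h : ∀ x, D x ≠ 0 → ξ ((D x)⁻¹ • u x) = δ ((D x)⁻¹ • u x) • x) {i : ℕ} (hi : i < n) :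
    vanishing k (flagImage c D u (i + 1)) < vanishing k (flagImage c D u i) := by
  refine lt_of_le_of_ne (vanishing_anti ?_) fun heq => ?_
  · rintro v ⟨x, hx, hx'⟩
    exact ⟨x, fun j hj => hx j (by omega), hx'⟩
  obtain ⟨p, hp⟩ := exists_eval_eq (hξ (c.coord ⟨i, hi⟩))
  have hpi : p ∈ vanishing k (flagImage c D u i) := mem_vanishing.mpr <| by
    rintro _ ⟨x, hx, hx', rfl⟩
    rw [hp, h x hx', map_smul, hx ⟨i, hi⟩ le_rfl, smul_zero]
  rw [← heq] at hpi
  obtain ⟨M, F, hF, hF'⟩ := exists_clear_denom hδ hu hD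
  have hline : IsPolyMap k (fun t : k => t • c ⟨i, hi⟩) :=
    .linear (LinearMap.toSpanSingleton k V (c ⟨i, hi⟩))
  obtain ⟨t, ht, ht'⟩ := exists_mul_ne_zero (k := k) (V := k)
    (polyFun_comp (mul_mem_polyFun hD hF) hline)
    (dual_mem_polyFun (LinearMap.id : k →ₗ[k] k)) (x := 0) (y := 1)
    (by simpa [hF' 0 hD₀, hD₀] using hδ₀) (by simp)
  have hDt := left_ne_zero_of_mul ht
  have hδt := right_ne_zero_of_mul ht
  rw [hF' _ hDt] at hδt
  have hmem : (D (t • c ⟨i, hi⟩))⁻¹ • u (t • c ⟨i, hi⟩) ∈ flagImage c D u (i + 1) :=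
    ⟨_, fun j hj => by
      have : (⟨i, hi⟩ : Fin n) ≠ j := fun h => by
        have := congrArg Fin.val h
        simp at this
        omega
      simp [this], hDt, rfl⟩
  have h0 := mem_vanishing.mp hpi _ hmem
  rw [hp, h _ hDt] at h0
  simp only [map_smul, smul_eq_mul, Module.Basis.coord_apply, Module.Basis.repr_self,
    Finsupp.single_eq_same, mul_one] at h0
  exact mul_ne_zero (right_ne_zero_of_mul hδt) ht' h0

/-- If the rational map `D⁻¹ u` has a rational left inverse `δ⁻¹ ξ`, then the image of a coordinate
subspace of dimension `r` has codimension `n - r`: the images of a complete flag through that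
subspace give a saturated chain of primes. -/
theorem height_vanishing_flagImage (hD : D ∈ polyFun k V) (hδ : δ ∈ polyFun k V)
    (hu : IsPolyMap k u) (hξ : IsPolyMap k ξ) (hD₀ : D 0 ≠ 0) (hδ₀ : δ ((D 0)⁻¹ • u 0) ≠ 0)
    (h : ∀ x, D x ≠ 0 → ξ ((D x)⁻¹ • u x) = δ ((D x)⁻¹ • u x) • x) {r : ℕ} (hr : r ≤ n) :
    (vanishing k (flagImage c D u r)).height + r = n := by
  have hprime := isPrime_vanishing_flagImage c hD hu hD₀
  have key : ∀ j i : ℕ, i + j ≤ n →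
      (vanishing k (flagImage c D u (i + j))).height + j ≤
        (vanishing k (flagImage c D u i)).height := by
    intro j
    induction j with
    | zero => intro i _; simp
    | succ j ih =>
      intro i hij
      have := hprime (i + j)
      have := hprime (i + j + 1)
      have h1 := Ideal.height_add_one_le_of_lt_of_isPrime
        (vanishing_flagImage_lt c hD hδ hu hξ hD₀ hδ₀ h (i := i + j) (by omega))
      calc _ = (vanishing k (flagImage c D u (i + j + 1))).height + 1 + j := by
            push_cast
            rw [add_assoc, add_comm (1 : ℕ∞)]
            rfl
        _ ≤ (vanishing k (flagImage c D u (i + j))).height + j := by gcongr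
        _ ≤ _ := ih i (by omega)
  apply le_antisymm
  · have h1 := key r 0 (by omega)
    rw [zero_add] at h1
    refine h1.trans ?_
    have := hprime 0
    have h2 := (vanishing k (flagImage c D u 0)).height_le_ringKrullDim_of_isPrime
    rw [MvPolynomial.ringKrullDim_of_isNoetherianRing, ringKrullDim_eq_zero_of_field,
      Nat.card_eq_fintype_card, Fintype.card_fin, zero_add] at h2
    have hn : Module.finrank k V = n := by
      rw [Module.finrank_eq_card_basis c, Fintype.card_fin]
    calc _ ≤ (Module.finrank k V : ℕ∞) := by exact_mod_cast h2
      _ = n := by rw [hn]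
  · have h1 := key (n - r) r (by omega)
    calc (n : ℕ∞) = ((n - r : ℕ) : ℕ∞) + r := by
          rw [← Nat.cast_add]; congr 1; omega
      _ ≤ _ := by
          gcongr
          exact le_trans le_add_self h1

end VanishingIdeals

/-! ### Orbits of unit groups of finite-dimensional algebras -/

section UnitOrbits

variable {k : Type*} [Field k]

/-- The units of a finite-dimensional algebra form a principal open subset. -/
theorem isUnit_iff_det_lmul_ne_zero {A : Type*} [Ring A] [Algebra k A] [Module.Finite k A]
    (a : A) : IsUnit a ↔ LinearMap.det (Algebra.lmul k A a) ≠ 0 := by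
  constructor
  · intro h
    exact ((h.map (Algebra.lmul k A)).map LinearMap.det).ne_zero
  · intro h
    have hu : IsUnit (Algebra.lmul k A a) := LinearMap.isUnit_iff_isUnit_det _ |>.mpr h.isUnit
    have hb := (Module.End.isUnit_iff _).mp hu
    obtain ⟨c, hc⟩ := hb.2 1
    have hac : a * c = 1 := hc
    have hca : c * a = 1 := hb.1 (show a * (c * a) = a * 1 by
      rw [← mul_assoc, hac, one_mul, mul_one])
    exact ⟨⟨a, c, hac, hca⟩, rfl⟩

variable {A B V : Type*} [Ring A] [Algebra k A] [Module.Finite k A] [Ring B] [Algebra k B]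
  [Module.Finite k B] [AddCommGroup V] [Module k V] [Module.Finite k V]

/-- The orbit of `η` under the product of the unit groups of two algebras acting on `V`. -/
def unitOrbit (ρ : A →ₐ[k] Module.End k V) (σ : B →ₐ[k] Module.End k V) (η : V) : Set V :=
  {v | ∃ (a : Aˣ) (b : Bˣ), v = ρ a (σ b η)}

/-- The orbit is irreducible, being the image of a principal open subset of `A × B`. -/
theorem isPrime_vanishing_unitOrbit [Infinite k] (ρ : A →ₐ[k] Module.End k V)
    (σ : B →ₐ[k] Module.End k V) (η : V) : (vanishing k (unitOrbit ρ σ η)).IsPrime := by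
  let D : A × B → k := fun e => LinearMap.det (Algebra.lmul k A e.1) *
    LinearMap.det (Algebra.lmul k B e.2)
  have hD : D ∈ polyFun k (A × B) := mul_mem_polyFun
    (det_mem_polyFun (.linear ((Algebra.lmul k A).toLinearMap ∘ₗ LinearMap.fst k A B)))
    (det_mem_polyFun (.linear ((Algebra.lmul k B).toLinearMap ∘ₗ LinearMap.snd k A B)))
  have hu : IsPolyMap k (fun e : A × B => D e • ρ e.1 (σ e.2 η)) :=
    .smul hD (.apply (.linear (ρ.toLinearMap ∘ₗ LinearMap.fst k A B))
      (.linear (LinearMap.applyₗ η ∘ₗ σ.toLinearMap ∘ₗ LinearMap.snd k A B)))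
  have hDiff : ∀ e : A × B, D e ≠ 0 ↔ IsUnit e.1 ∧ IsUnit e.2 := fun e => by
    rw [isUnit_iff_det_lmul_ne_zero (k := k), isUnit_iff_det_lmul_ne_zero (k := k)]
    exact mul_ne_zero_iff
  convert isPrime_vanishing_rational hD hu (x₀ := 1) ((hDiff 1).mpr ⟨isUnit_one, isUnit_one⟩)
    using 2
  ext v
  constructor
  · rintro ⟨a, b, rfl⟩
    have h : D (a, b) ≠ 0 := (hDiff (a, b)).mpr ⟨a.isUnit, b.isUnit⟩
    exact ⟨(a, b), h, by simp only [inv_smul_smul₀ h]⟩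
  · rintro ⟨e, he, rfl⟩
    obtain ⟨⟨a, ha⟩, ⟨b, hb⟩⟩ := (hDiff e).mp he
    exact ⟨a, b, by simp only [inv_smul_smul₀ he, ha, hb]⟩

/-- The codimension of the orbit of `η` is the corank of the tangent map `L` at `η`. -/
theorem height_unitOrbit [Infinite k] (ρ : A →ₐ[k] Module.End k V)
    (σ : B →ₐ[k] Module.End k V) (hc : ∀ a b v, ρ a (σ b v) = σ b (ρ a v)) (η : V)
    (L : A × B →ₗ[k] V) (hL : ∀ e, L e = ρ e.1 η - σ e.2 η) :
    (vanishing k (unitOrbit ρ σ η)).height + Module.finrank k (LinearMap.range L) =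
      Module.finrank k V := by
  let R := LinearMap.range L
  obtain ⟨R', hRR'⟩ := R.exists_isCompl
  let P₀ : V →ₗ[k] R := R.projectionOnto R' hRR'
  obtain ⟨s₀, hs₀⟩ := L.rangeRestrict.exists_rightInverse_of_surjective L.range_rangeRestrict
  -- `P` is a projection onto the tangent space `R`, and `s` is a linear section of `L` over it.
  let P : V →ₗ[k] V := R.subtype ∘ₗ P₀
  let Q : V →ₗ[k] V := LinearMap.id - P
  let s : V →ₗ[k] A × B := s₀ ∘ₗ P₀
  have hPR : ∀ x ∈ R, P x = x := fun x hx => by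
    change ((P₀ x : R) : V) = x
    rw [show P₀ x = ⟨x, hx⟩ from Submodule.projectionOnto_apply_left hRR' ⟨x, hx⟩]
  have hPmem : ∀ x, P x ∈ R := fun x => (P₀ x).2
  have hPP : ∀ x, P (P x) = P x := fun x => hPR _ (hPmem x)
  have hPQ : ∀ x, P (x - P x) = 0 := fun x => by rw [map_sub, hPP, sub_self]
  have hQ : ∀ x, Q x = x - P x := fun x => rfl
  have hsP : ∀ x, s (P x) = s x := fun x => by
    change s₀ (P₀ (P₀ x : V)) = s₀ (P₀ x)
    rw [show P₀ (P₀ x : V) = P₀ x from Submodule.projectionOnto_apply_left hRR' _]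
  have hLs : ∀ x, L (s x) = P x := fun x =>
    congrArg Subtype.val (LinearMap.congr_fun hs₀ (P₀ x))
  -- `T v` is the linearization at `v` of the equation `a • η = v • b`.
  let T : V → A × B →ₗ[k] V := fun v =>
    LinearMap.applyₗ η ∘ₗ ρ.toLinearMap ∘ₗ LinearMap.fst k A B -
      LinearMap.applyₗ v ∘ₗ σ.toLinearMap ∘ₗ LinearMap.snd k A B
  have hT : ∀ v e, T v e = ρ e.1 η - σ e.2 v := fun v e => rfl
  have hTη : ∀ e, T η e = L e := fun e => (hL e).symm
  -- `K v` restricts to `P ∘ T v ∘ s` on `R` and is the identity modulo `R`; at `v = η` it is the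
  -- identity. Where it is invertible, `v` determines the parameter `x` of the chart below.
  let K : V → V →ₗ[k] V := fun v => P ∘ₗ T v ∘ₗ s + Q
  have hK : ∀ v x, K v x = P (T v (s x)) + (x - P x) := fun v x => rfl
  have hKpoly : IsPolyMap k K := by
    have h1 : ∀ v, K v = (P ∘ₗ LinearMap.applyₗ η ∘ₗ ρ.toLinearMap ∘ₗ LinearMap.fst k A B ∘ₗ s + Q)
        - ((σ.toLinearMap ∘ₗ LinearMap.snd k A B ∘ₗ s).flip.compr₂ P) v := fun v => by
      ext x
      simp only [hK, hT, map_sub, LinearMap.sub_apply, LinearMap.add_apply, LinearMap.comp_apply,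
        LinearMap.compr₂_apply, LinearMap.flip_apply, hQ]
      change P (ρ (s x).1 η) - P (σ (s x).2 v) + (x - P x) =
        P (ρ (s x).1 η) + (x - P x) - P (σ (s x).2 v)
      abel
    rw [show K = _ from funext h1]
    exact .sub (.const _) (.linear _)
  obtain ⟨adjK, hadjK, hadjK₁, -⟩ := exists_adjugate hKpoly
  let δ : V → k := fun v => LinearMap.det (K v)
  have hδ : δ ∈ polyFun k V := det_mem_polyFun hKpoly
  have hδη : δ η = 1 := by
    have : K η = LinearMap.id := by
      ext x
      simp [hK, hTη, hLs, hPP]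
    simp [δ, this]
  let w : V → V := fun v => adjK v (P (v - η))
  have hw : IsPolyMap k w :=
    .apply hadjK ((IsPolyMap.linear P).comp ((IsPolyMap.linear LinearMap.id).sub (.const η)))
  -- `δ⁻¹ ξ` is the inverse of the chart: `δ⁻¹ w` recovers `P x` and the other summand `Q x`.
  let ξ : V → V := fun v => w v + Q (δ v • (η - v) + T v (s (w v)))
  have hξ : IsPolyMap k ξ := by
    have h1 : IsPolyMap k (fun v => s (w v)) := (IsPolyMap.linear s).comp hw
    refine hw.add ((IsPolyMap.linear Q).comp (.add (.smul hδ
      (.sub (.const η) (.linear LinearMap.id))) (.sub ?_ ?_)))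
    · exact (IsPolyMap.linear (LinearMap.applyₗ η ∘ₗ ρ.toLinearMap ∘ₗ LinearMap.fst k A B)).comp h1
    · exact .apply ((IsPolyMap.linear (σ.toLinearMap ∘ₗ LinearMap.snd k A B)).comp h1)
        (.linear LinearMap.id)
  let a : V → A := fun x => 1 + (s x).1
  let b : V → B := fun x => 1 + (s x).2
  have ha : IsPolyMap k a := .add (.const 1) (.linear (LinearMap.fst k A B ∘ₗ s))
  have hb : IsPolyMap k b := .add (.const 1) (.linear (LinearMap.snd k A B ∘ₗ s))
  have hσb : IsPolyMap k (fun x => σ (b x)) := (IsPolyMap.linear σ.toLinearMap).comp hb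
  have hTs : ∀ v x, T v (s x) = ρ (a x) η - η - (σ (b x) v - v) := fun v x => by
    simp [hT, a, b]
  obtain ⟨adjS, hadjS, -, hadjS₂⟩ := exists_adjugate hσb
  let D₀ : V → k := fun x =>
    LinearMap.det (Algebra.lmul k A (a x)) * LinearMap.det (Algebra.lmul k B (b x))
  have hD₀poly : D₀ ∈ polyFun k V := mul_mem_polyFun
    (det_mem_polyFun ((IsPolyMap.linear (Algebra.lmul k A).toLinearMap).comp ha))
    (det_mem_polyFun ((IsPolyMap.linear (Algebra.lmul k B).toLinearMap).comp hb))
  let D : V → k := fun x => D₀ x * LinearMap.det (σ (b x))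
  have hD : D ∈ polyFun k V := mul_mem_polyFun hD₀poly (det_mem_polyFun hσb)
  have hD0 : D 0 = 1 := by
    have ha0 : a 0 = 1 := by simp [a]
    have hb0 : b 0 = 1 := by simp [b]
    simp only [D, D₀, ha0, hb0, map_one, mul_one]
  -- `D⁻¹ u` sends `x` to the solution `v` of `a • η - v • b = Q x` for `(a, b) = 1 + s x`.
  let u : V → V := fun x => D₀ x • adjS x (ρ (a x) η - Q x)
  have hu : IsPolyMap k u := .smul hD₀poly (.apply hadjS (.sub
    ((IsPolyMap.linear (LinearMap.applyₗ η ∘ₗ ρ.toLinearMap)).comp ha) (.linear Q)))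
  have hua : ∀ x, D x ≠ 0 → IsUnit (a x) := fun x hx =>
    (isUnit_iff_det_lmul_ne_zero (k := k) _).mpr (left_ne_zero_of_mul (left_ne_zero_of_mul hx))
  have hub : ∀ x, D x ≠ 0 → IsUnit (b x) := fun x hx =>
    (isUnit_iff_det_lmul_ne_zero (k := k) _).mpr (right_ne_zero_of_mul (left_ne_zero_of_mul hx))
  have hσinj : ∀ y : B, IsUnit y → Function.Injective (σ y) := fun y hy =>
    ((Module.End.isUnit_iff _).mp (hy.map σ)).1
  have hv : ∀ x, D x ≠ 0 → σ (b x) ((D x)⁻¹ • u x) = ρ (a x) η - Q x := fun x hx => by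
    simp only [u, map_smul, hadjS₂]
    rw [smul_smul, smul_smul, mul_assoc]
    exact (congrArg (· • _) (inv_mul_cancel₀ hx)).trans (one_smul _ _)
  have hv0 : (D 0)⁻¹ • u 0 = η := by
    have := hv 0 (by rw [hD0]; exact one_ne_zero)
    simpa [a, b] using this
  have hwv : ∀ v x, P (T v (s x)) = P (v - η) → w v = δ v • P x := fun v x hx => by
    have : K v (P x) = P (v - η) := by rw [hK, hsP, hPP, sub_self, add_zero, hx]
    simp only [w, ← this, hadjK₁, δ]
  have hchart : ∀ x, D x ≠ 0 → ξ ((D x)⁻¹ • u x) = δ ((D x)⁻¹ • u x) • x := fun x hx => by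
    have h1 := hv x hx
    generalize (D x)⁻¹ • u x = v at h1
    have h2 : T v (s x) = Q x + (v - η) := by rw [hTs, h1]; abel
    have h3 := hwv v x (by rw [h2, map_add, hQ, hPQ, zero_add])
    simp only [ξ, h3, map_smul, hsP, h2]
    rw [← smul_add, map_smul, ← smul_add]
    congr 1
    rw [show η - v + (Q x + (v - η)) = Q x by abel, hQ (Q x), hQ x, hPQ]
    abel
  obtain ⟨c, hcR⟩ := exists_adapted_basis R
  have hheight := height_vanishing_flagImage c hD hδ hu hξ (by rw [hD0]; exact one_ne_zero)
    (by rw [hv0, hδη]; exact one_ne_zero) hchart R.finrank_le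
  suffices h : vanishing k (unitOrbit ρ σ η) = vanishing k (flagImage c D u (Module.finrank k R)) by
    rw [h]; exact hheight
  apply le_antisymm
  · apply vanishing_anti
    rintro v ⟨x, hx, hDx, hxv⟩
    have h1 := hv x hDx
    rw [← hxv, hQ, hPR x ((hcR x).mp hx), sub_self, sub_zero] at h1
    obtain ⟨a', ha'⟩ := hua x hDx
    obtain ⟨b', hb'⟩ := hub x hDx
    refine ⟨a', b'⁻¹, ?_⟩
    apply hσinj b' b'.isUnit
    rw [hc, ← Module.End.mul_apply (σ _) (σ _), ← map_mul, Units.mul_inv, map_one,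
      Module.End.one_apply, ha', hb', h1]
  · intro p hp
    -- The chart covers the points of the orbit at which `δ` and `D ∘ (δ⁻¹ ξ)` do not vanish.
    obtain ⟨M, G, hG, hG'⟩ := exists_clear_denom hD hξ hδ
    obtain ⟨q, hq⟩ := exists_eval_eq (mul_mem_polyFun hδ hG)
    have hprime := isPrime_vanishing_unitOrbit ρ σ η
    have hη : η ∈ unitOrbit ρ σ η := ⟨1, 1, by simp⟩
    have hqη : q ∉ vanishing k (unitOrbit ρ σ η) := fun h => by
      have h1 := mem_vanishing.mp h η hη
      have h2 : ξ η = 0 := by simp [ξ, w]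
      rw [hq, hG' η (by rw [hδη]; exact one_ne_zero), hδη, h2] at h1
      simp [hD0] at h1
    refine (hprime.mem_or_mem (x := p) (y := q) ?_).resolve_right hqη
    refine mem_vanishing.mpr fun v hvO => ?_
    rw [map_mul, hq]
    by_cases he : δ v * G v = 0
    · rw [he, mul_zero]
    have hδv := left_ne_zero_of_mul he
    have hGv := right_ne_zero_of_mul he
    rw [hG' v hδv] at hGv
    have hDv := right_ne_zero_of_mul hGv
    obtain ⟨a₀, b₀, hab⟩ := hvO
    have hKinj : Function.Injective (K v) :=
      ((Module.End.isUnit_iff _).mp ((LinearMap.isUnit_iff_isUnit_det _).mpr hδv.isUnit)).1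
    -- By homogeneity the linearization has the same rank at all points of the orbit.
    have hrange : LinearMap.range (T v) ≤ R.map (ρ a₀ : V →ₗ[k] V) := by
      rintro _ ⟨e, rfl⟩
      refine ⟨L ((a₀⁻¹ : Aˣ) * e.1, e.2 * b₀), ⟨_, rfl⟩, ?_⟩
      rw [hL, hT, map_sub, hab]
      congr 1
      · rw [map_mul, Module.End.mul_apply, ← Module.End.mul_apply, ← map_mul, Units.mul_inv,
          map_one, Module.End.one_apply]
      · rw [map_mul, Module.End.mul_apply, ← hc]
    let S : R →ₗ[k] V := T v ∘ₗ s ∘ₗ R.subtype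
    have hSinj : Function.Injective S := by
      rw [← LinearMap.ker_eq_bot, LinearMap.ker_eq_bot']
      intro x hx
      have h1 : T v (s x) = 0 := hx
      have : K v x = 0 := by rw [hK, h1, map_zero, hPR x x.2, sub_self, add_zero]
      exact Subtype.ext (hKinj (this.trans (map_zero _).symm))
    have hST : LinearMap.range S = LinearMap.range (T v) := by
      apply Submodule.eq_of_le_of_finrank_le
      · rintro _ ⟨x, rfl⟩
        exact ⟨_, rfl⟩
      · rw [LinearMap.finrank_range_of_inj hSinj]
        exact (Submodule.finrank_mono hrange).trans (Submodule.finrank_map_le _ _)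
    have hmem : v - η ∈ LinearMap.range (T v) := ⟨-1, by simp [hT]; abel⟩
    rw [← hST] at hmem
    obtain ⟨x, hx⟩ := hmem
    have hx' : T v (s x) = v - η := hx
    have hwx : w v = δ v • (x : V) := by rw [hwv v x (by rw [hx']), hPR x x.2]
    have hξv : (δ v)⁻¹ • ξ v = x := by
      simp only [ξ, hwx, map_smul, hx']
      rw [← smul_add, show η - v + (v - η) = 0 by abel, smul_zero, map_zero, add_zero,
        inv_smul_smul₀ hδv]
    rw [hξv] at hDv
    have hvx : v = (D x)⁻¹ • u x := by
      apply hσinj _ (hub x hDv)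
      rw [hv x hDv, hQ, hPR x x.2, sub_self, sub_zero]
      have := hTs v x
      rw [hx'] at this
      have h2 : ρ (a x) η - σ (b x) v = 0 := by
        calc _ = ρ (a x) η - η - (σ (b x) v - v) - (v - η) := by abel
          _ = 0 := by rw [← this, sub_self]
      exact (sub_eq_zero.mp h2).symm
    rw [mem_vanishing.mp hp v ⟨x, (hcR x).mpr x.2, hDv, hvx⟩, zero_mul]

end UnitOrbits

/-! ### Direct summands and rigidity -/

section Summands

variable {C : Type*} [Category C] [Preadditive C] [HasZeroObject C] [HasShift C ℤ]
  [∀ n : ℤ, (shiftFunctor C n).Additive] [Pretriangulated C]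

theorem IsDirectSummand.exists_retract {X Y : C} (h : IsDirectSummand Y X) :
    ∃ (i : Y ⟶ X) (r : X ⟶ Y), i ≫ r = 𝟙 Y := by
  obtain ⟨Z, ⟨e⟩⟩ := h
  exact ⟨biprod.inl ≫ e.inv, e.hom ≫ biprod.fst, by simp⟩

theorem isDirectSummand_of_retract [IsIdempotentComplete C] {X Y : C} (i : Y ⟶ X) (r : X ⟶ Y)
    (h : i ≫ r = 𝟙 Y) : IsDirectSummand Y X := by
  obtain ⟨Z, j, q, hjq, hqj⟩ := IsIdempotentComplete.idempotents_split X (𝟙 X - r ≫ i) (by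
    simp [reassoc_of% h])
  have hiq : i ≫ q = 0 := by
    have : (i ≫ q) ≫ j = 0 := by
      rw [Category.assoc, hqj]; simp [reassoc_of% h]
    calc i ≫ q = ((i ≫ q) ≫ j) ≫ q := by simp [hjq]
      _ = 0 := by rw [this, zero_comp]
  have hjr : j ≫ r = 0 := by
    have : q ≫ j ≫ r = 0 := by
      rw [← Category.assoc, hqj]; simp [h]
    calc j ≫ r = j ≫ q ≫ j ≫ r := by rw [← Category.assoc, hjq, Category.id_comp]
      _ = 0 := by rw [this, comp_zero]
  refine ⟨Z, ⟨⟨biprod.lift r q, biprod.desc i j, ?_, ?_⟩⟩⟩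
  · rw [biprod.lift_desc, hqj]; abel
  · ext <;> simp [h, hiq, hjr, hjq]

/-- A map into a shifted object of `add T` vanishes if all maps from its source to `Σ T` do. -/
theorem InAdd.hom_shift_eq_zero {T Y : C} (hY : InAdd T Y) {X : C}
    (hX : ∀ f : X ⟶ T⟦(1 : ℤ)⟧, f = 0) (f : X ⟶ Y⟦(1 : ℤ)⟧) : f = 0 := by
  obtain ⟨n, h⟩ := hY
  obtain ⟨i, r, hir⟩ := h.exists_retract
  have hg : f ≫ i⟦(1 : ℤ)⟧' = 0 := by
    calc f ≫ i⟦(1 : ℤ)⟧' = (f ≫ i⟦(1 : ℤ)⟧') ≫ (𝟙 (⨁ fun _ : Fin n => T))⟦(1 : ℤ)⟧' := by simp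
      _ = 0 := by
        rw [← biproduct.total, Functor.map_sum, Preadditive.comp_sum]
        refine Finset.sum_eq_zero fun j _ => ?_
        rw [Functor.map_comp, ← Category.assoc, hX (_ ≫ _), zero_comp]
  calc f = f ≫ (i ≫ r)⟦(1 : ℤ)⟧' := by rw [hir]; simp
    _ = 0 := by rw [Functor.map_comp, ← Category.assoc, hg, zero_comp]

theorem InAdd.hom_eq_zero {T X : C} (hX : InAdd T X) {Y : C} (hY : ∀ f : T ⟶ Y, f = 0)
    (f : X ⟶ Y) : f = 0 := by
  obtain ⟨n, h⟩ := hX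
  obtain ⟨i, r, hir⟩ := h.exists_retract
  have hg : r ≫ f = 0 := biproduct.hom_ext' _ _ fun j => by rw [hY (_ ≫ _), comp_zero]
  calc f = i ≫ r ≫ f := by rw [← Category.assoc, hir, Category.id_comp]
    _ = 0 := by rw [hg, comp_zero]

theorem IsRigid.hom_shift_eq_zero {T X Y : C} (hT : IsRigid T) (hX : InAdd T X) (hY : InAdd T Y)
    (f : X ⟶ Y⟦(1 : ℤ)⟧) : f = 0 :=
  hX.hom_eq_zero (fun g => hY.hom_shift_eq_zero hT g) f

end Summands

/-! ### Linear maps between morphism spaces -/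

section LinearMaps

variable {k : Type*} [Field k] {C : Type*} [Category C] [Preadditive C] [Linear k C] {T₀ T₁ Z : C}

variable (k) in
/-- The tangent map at `η` of the action of `Aut T₀ × Aut T₁`. -/
def tangentMap (η : T₁ ⟶ T₀) : End T₀ × (End T₁)ᵐᵒᵖ →ₗ[k] (T₁ ⟶ T₀) :=
  Linear.leftComp k T₀ η ∘ₗ LinearMap.fst k (End T₀) (End T₁)ᵐᵒᵖ -
    Linear.rightComp k T₁ η ∘ₗ (MulOpposite.opLinearEquiv k).symm.toLinearMap ∘ₗ
      LinearMap.snd k (End T₀) (End T₁)ᵐᵒᵖ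

/-- `End T₀` acting on `C(T₁, T₀)` by composition. -/
def endAction (T₁ T₀ : C) : End T₀ →ₐ[k] Module.End k (T₁ ⟶ T₀) :=
  AlgHom.ofLinearMap
    { toFun := fun a => Linear.rightComp k T₁ (a : T₀ ⟶ T₀)
      map_add' := fun a b => LinearMap.ext fun f => Preadditive.comp_add _ _ _ f a b
      map_smul' := fun c a => LinearMap.ext fun f => Linear.comp_smul _ _ _ f c (a : T₀ ⟶ T₀) }
    (LinearMap.ext fun f => Category.comp_id f)
    (fun a b => LinearMap.ext fun f => (Category.assoc f (b : T₀ ⟶ T₀) (a : T₀ ⟶ T₀)).symm)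

/-- The opposite algebra of `End T₁` acting on `C(T₁, T₀)` by precomposition. -/
def endOpAction (T₁ T₀ : C) : (End T₁)ᵐᵒᵖ →ₐ[k] Module.End k (T₁ ⟶ T₀) :=
  AlgHom.ofLinearMap
    { toFun := fun b => Linear.leftComp k T₀ (b.unop : T₁ ⟶ T₁)
      map_add' := fun a b => LinearMap.ext fun f =>
        Preadditive.add_comp _ _ _ (a.unop : T₁ ⟶ T₁) b.unop f
      map_smul' := fun c a => LinearMap.ext fun f => Linear.smul_comp _ _ _ c (a.unop : T₁ ⟶ T₁) f }
    (LinearMap.ext fun f => Category.id_comp f)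
    (fun a b => LinearMap.ext fun f => Category.assoc (a.unop : T₁ ⟶ T₁) (b.unop : T₁ ⟶ T₁) f)

theorem autOrbit_eq_unitOrbit (η : T₁ ⟶ T₀) :
    autOrbit η = unitOrbit (endAction (k := k) T₁ T₀) (endOpAction T₁ T₀) η := by
  ext v
  constructor
  · rintro ⟨g₀, g₁, rfl⟩
    refine ⟨⟨g₀.hom, g₀.inv, g₀.inv_hom_id, g₀.hom_inv_id⟩,
      ⟨MulOpposite.op g₁.inv, MulOpposite.op g₁.hom, ?_, ?_⟩, (Category.assoc _ _ _).symm⟩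
    · exact congrArg MulOpposite.op g₁.inv_hom_id
    · exact congrArg MulOpposite.op g₁.hom_inv_id
  · rintro ⟨a, b, rfl⟩
    refine ⟨⟨a.val, a.inv, a.inv_val, a.val_inv⟩, ⟨b.inv.unop, b.val.unop, ?_, ?_⟩, ?_⟩
    · exact congrArg MulOpposite.unop b.inv_val
    · exact congrArg MulOpposite.unop b.val_inv
    · exact Category.assoc _ _ _

/-- The codimension of the orbit of `η` is the codimension of its tangent space. -/
theorem zariskiCodim_autOrbit [Infinite k] [∀ X Y : C, Module.Finite k (X ⟶ Y)]
    (η : T₁ ⟶ T₀) :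
    zariskiCodim k (autOrbit η) + Module.finrank k (LinearMap.range (tangentMap k η)) =
      Module.finrank k (T₁ ⟶ T₀) := by
  have : Module.Finite k (End T₀) := inferInstanceAs (Module.Finite k (T₀ ⟶ T₀))
  have : Module.Finite k (End T₁) := inferInstanceAs (Module.Finite k (T₁ ⟶ T₁))
  rw [autOrbit_eq_unitOrbit (k := k)]
  exact height_unitOrbit (endAction T₁ T₀) (endOpAction T₁ T₀)
    (fun a b v => Category.assoc (b.unop : T₁ ⟶ T₁) v (a : T₀ ⟶ T₀)) η (tangentMap k η)
    (fun e => rfl)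

variable [HasShift C ℤ]

variable (k) in
/-- The map `C(Σ T₁, Σ T₀) ⟶ C(Z, Σ Z)` given by the morphisms `p` and `Σ ι` of a triangle. -/
def throughShift (ι : T₀ ⟶ Z) (p : Z ⟶ T₁⟦(1 : ℤ)⟧) :
    (T₁⟦(1 : ℤ)⟧ ⟶ T₀⟦(1 : ℤ)⟧) →ₗ[k] (Z ⟶ Z⟦(1 : ℤ)⟧) :=
  Linear.leftComp k (Z⟦(1 : ℤ)⟧) p ∘ₗ Linear.rightComp k (T₁⟦(1 : ℤ)⟧) (ι⟦(1 : ℤ)⟧')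

theorem throughShift_apply (ι : T₀ ⟶ Z) (p : Z ⟶ T₁⟦(1 : ℤ)⟧) (m) :
    throughShift k ι p m = p ≫ m ≫ ι⟦(1 : ℤ)⟧' := rfl

variable (k) in
/-- The map `C(Z, Σ Z) ⟶ C(T₀, Σ² T₁)` given by the morphisms `ι` and `Σ p` of a triangle. -/
def restrictToEnds (ι : T₀ ⟶ Z) (p : Z ⟶ T₁⟦(1 : ℤ)⟧) :
    (Z ⟶ Z⟦(1 : ℤ)⟧) →ₗ[k] (T₀ ⟶ T₁⟦(1 : ℤ)⟧⟦(1 : ℤ)⟧) :=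
  Linear.leftComp k (T₁⟦(1 : ℤ)⟧⟦(1 : ℤ)⟧) ι ∘ₗ Linear.rightComp k Z (p⟦(1 : ℤ)⟧')

theorem restrictToEnds_apply (ι : T₀ ⟶ Z) (p : Z ⟶ T₁⟦(1 : ℤ)⟧) (g) :
    restrictToEnds k ι p g = ι ≫ g ≫ p⟦(1 : ℤ)⟧' := rfl

variable [∀ n : ℤ, (shiftFunctor C n).Additive] [∀ n : ℤ, (shiftFunctor C n).Linear k]

variable (k) in
/-- Suspension on morphism spaces, as a linear isomorphism. -/
noncomputable def shiftHomEquiv (X Y : C) : (X ⟶ Y) ≃ₗ[k] (X⟦(1 : ℤ)⟧ ⟶ Y⟦(1 : ℤ)⟧) :=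
  LinearEquiv.ofBijective ((shiftFunctor C (1 : ℤ)).mapLinearMap k)
    ⟨(shiftFunctor C (1 : ℤ)).map_injective, (shiftFunctor C (1 : ℤ)).map_surjective⟩

theorem shiftHomEquiv_apply {X Y : C} (f : X ⟶ Y) : shiftHomEquiv k X Y f = f⟦(1 : ℤ)⟧' := rfl

/-- The Calabi-Yau duality identifies `restrictToEnds` with the transpose of `throughShift`. -/
theorem finrank_range_restrictToEnds (hCY : IsTwoCalabiYau k C) (ι : T₀ ⟶ Z)
    (p : Z ⟶ T₁⟦(1 : ℤ)⟧) :
    Module.finrank k (LinearMap.range (restrictToEnds k ι p)) =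
      Module.finrank k (LinearMap.range (throughShift k ι p)) := by
  obtain ⟨e, he₁, he₂⟩ := hCY
  let τ := shiftFunctorAdd' C (1 : ℤ) 1 2 rfl
  let θ : ∀ X Y : C, (X ⟶ Y⟦(1 : ℤ)⟧) ≃ₗ[k] (X⟦(1 : ℤ)⟧ ⟶ Y⟦(2 : ℤ)⟧) := fun X Y =>
    shiftHomEquiv k X (Y⟦(1 : ℤ)⟧) ≪≫ₗ Linear.homCongr k (Iso.refl _) (τ.symm.app Y)
  have hθ : ∀ (X Y : C) f, θ X Y f = f⟦(1 : ℤ)⟧' ≫ τ.inv.app Y := fun X Y f => by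
    simp [θ, Linear.homCongr_apply, shiftHomEquiv_apply]
  have key : (restrictToEnds k ι p) ∘ₗ (e Z (Z⟦(1 : ℤ)⟧) ≪≫ₗ (θ _ _).symm).toLinearMap =
      (e (T₁⟦(1 : ℤ)⟧) (T₀⟦(1 : ℤ)⟧) ≪≫ₗ (θ _ _).symm).toLinearMap ∘ₗ
        (throughShift k ι p).dualMap := by
    ext φ
    apply (θ _ _).injective
    simp only [LinearMap.comp_apply, LinearEquiv.coe_coe, LinearEquiv.trans_apply,
      LinearEquiv.apply_symm_apply]
    have h1 : (throughShift k ι p).dualMap φ =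
        (φ.comp (Linear.leftComp k (Z⟦(1 : ℤ)⟧) p)).comp
          (Linear.rightComp k (T₁⟦(1 : ℤ)⟧) (ι⟦(1 : ℤ)⟧')) := rfl
    rw [h1, he₂, he₁]
    obtain ⟨g, hg⟩ := (θ Z Z).surjective (e Z (Z⟦(1 : ℤ)⟧) φ)
    rw [← hg, LinearEquiv.symm_apply_apply, restrictToEnds_apply, hθ, hθ]
    simp only [Functor.map_comp, Category.assoc]
    congr 2
    exact τ.inv.naturality p
  have h2 := congrArg (fun f => Module.finrank k (LinearMap.range f)) key
  rw [LinearMap.range_comp, LinearEquiv.range, Submodule.map_top, LinearMap.range_comp,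
    LinearEquiv.finrank_map_eq, LinearMap.finrank_range_dualMap_eq_finrank_range] at h2
  exact h2

end LinearMaps

/-! ### Exactness of morphism functors on a triangle -/

section Exactness

variable {C : Type*} [Category C] [Preadditive C] [HasZeroObject C] [HasShift C ℤ]
  [∀ n : ℤ, (shiftFunctor C n).Additive] [Pretriangulated C]
  {T₀ T₁ Z X : C} {η : T₁ ⟶ T₀} {ι : T₀ ⟶ Z} {p : Z ⟶ T₁⟦(1 : ℤ)⟧}

theorem exists_eq_comp_mor₁ (hT : Triangle.mk η ι p ∈ distTriang C) (f : X ⟶ T₀)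
    (hf : f ≫ ι = 0) : ∃ g : X ⟶ T₁, f = g ≫ η :=
  Triangle.coyoneda_exact₂ _ hT f hf

theorem exists_eq_comp_mor₂ (hT : Triangle.mk η ι p ∈ distTriang C) (f : X ⟶ Z)
    (hf : f ≫ p = 0) : ∃ g : X ⟶ T₀, f = g ≫ ι :=
  Triangle.coyoneda_exact₃ _ hT f hf

theorem exists_eq_mor₃_comp (hT : Triangle.mk η ι p ∈ distTriang C) (f : Z ⟶ X)
    (hf : ι ≫ f = 0) : ∃ g : T₁⟦(1 : ℤ)⟧ ⟶ X, f = p ≫ g :=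
  Triangle.yoneda_exact₃ _ hT f hf

theorem exists_eq_shift_mor₁_comp (hT : Triangle.mk η ι p ∈ distTriang C)
    (f : T₁⟦(1 : ℤ)⟧ ⟶ X) (hf : p ≫ f = 0) :
    ∃ g : T₀⟦(1 : ℤ)⟧ ⟶ X, f = η⟦(1 : ℤ)⟧' ≫ g := by
  obtain ⟨(g : T₀⟦(1 : ℤ)⟧ ⟶ X), (hg : f = (-(η⟦(1 : ℤ)⟧')) ≫ g)⟩ :=
    Triangle.yoneda_exact₃ _ (rot_of_distTriang _ hT) f hf
  exact ⟨-g, by rw [hg, Preadditive.neg_comp, Preadditive.comp_neg]⟩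

theorem exists_eq_comp_shift_mor₁ (hT : Triangle.mk η ι p ∈ distTriang C)
    (f : X ⟶ T₀⟦(1 : ℤ)⟧) (hf : f ≫ ι⟦(1 : ℤ)⟧' = 0) :
    ∃ g : X ⟶ T₁⟦(1 : ℤ)⟧, f = g ≫ η⟦(1 : ℤ)⟧' := by
  obtain ⟨(g : X ⟶ T₁⟦(1 : ℤ)⟧), (hg : f = g ≫ (-(η⟦(1 : ℤ)⟧')))⟩ :=
    Triangle.coyoneda_exact₁ _ (rot_of_distTriang _ hT) f hf
  exact ⟨-g, by rw [hg, Preadditive.neg_comp, Preadditive.comp_neg]⟩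

theorem exists_eq_comp_shift_mor₂ (hT : Triangle.mk η ι p ∈ distTriang C)
    (f : X ⟶ Z⟦(1 : ℤ)⟧) (hf : f ≫ p⟦(1 : ℤ)⟧' = 0) :
    ∃ g : X ⟶ T₀⟦(1 : ℤ)⟧, f = g ≫ ι⟦(1 : ℤ)⟧' :=
  exists_eq_comp_shift_mor₁ (rot_of_distTriang _ hT) f hf

end Exactness

/-! ### The self-extensions of a cone -/

section Cones

variable {k : Type*} [Field k] {C : Type*} [Category C] [Preadditive C] [Linear k C]
  [HasZeroObject C] [HasShift C ℤ] [∀ n : ℤ, (shiftFunctor C n).Additive] [Pretriangulated C]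
  {T₀ T₁ Z : C} {η : T₁ ⟶ T₀} {ι : T₀ ⟶ Z} {p : Z ⟶ T₁⟦(1 : ℤ)⟧}

/-- By rigidity, a morphism `Z ⟶ Σ Z` whose composite `T₀ ⟶ Z ⟶ Σ Z ⟶ Σ² T₁` vanishes factors as
`Z ⟶ Σ T₁ ⟶ Σ T₀ ⟶ Σ Z`. -/
theorem range_throughShift (hT : Triangle.mk η ι p ∈ distTriang C)
    (h₀₀ : ∀ f : T₀ ⟶ T₀⟦(1 : ℤ)⟧, f = 0) (h₁₁ : ∀ f : T₁ ⟶ T₁⟦(1 : ℤ)⟧, f = 0) :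
    LinearMap.range (throughShift k ι p) = LinearMap.ker (restrictToEnds k ι p) := by
  ext g
  rw [LinearMap.mem_ker, restrictToEnds_apply]
  constructor
  · rintro ⟨m, rfl⟩
    have h : ι ≫ p = 0 := comp_distTriang_mor_zero₂₃ _ hT
    rw [throughShift_apply, Category.assoc, ← Category.assoc ι, h, zero_comp]
  · intro hg
    obtain ⟨u, hu⟩ := exists_eq_mor₃_comp hT (g ≫ p⟦(1 : ℤ)⟧') hg
    obtain ⟨u, rfl⟩ := (shiftFunctor C (1 : ℤ)).map_surjective u
    rw [h₁₁ u, Functor.map_zero, comp_zero] at hu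
    obtain ⟨h, rfl⟩ := exists_eq_comp_shift_mor₂ hT g hu
    obtain ⟨m, rfl⟩ := exists_eq_mor₃_comp hT h (h₀₀ _)
    exact ⟨m, by rw [throughShift_apply, Category.assoc]⟩

variable [∀ n : ℤ, (shiftFunctor C n).Linear k]

/-- A morphism `Σ T₁ ⟶ Σ T₀` dies in `C(Z, Σ Z)` exactly if it is the suspension of a tangent
vector to the orbit of `η`. -/
theorem ker_throughShift (hT : Triangle.mk η ι p ∈ distTriang C)
    (h₀₁ : ∀ f : T₀ ⟶ T₁⟦(1 : ℤ)⟧, f = 0) :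
    LinearMap.ker (throughShift k ι p) =
      (LinearMap.range (tangentMap k η)).map (shiftHomEquiv k T₁ T₀ : _ →ₗ[k] _) := by
  ext m
  rw [LinearMap.mem_ker, throughShift_apply]
  constructor
  · intro hm
    obtain ⟨g, hg⟩ := exists_eq_comp_shift_mor₁ hT (p ≫ m) (by rwa [Category.assoc])
    obtain ⟨b', rfl⟩ := exists_eq_mor₃_comp hT g (h₀₁ _)
    obtain ⟨b, rfl⟩ := (shiftFunctor C (1 : ℤ)).map_surjective b'
    obtain ⟨a', ha⟩ := exists_eq_shift_mor₁_comp hT (m - (b ≫ η)⟦(1 : ℤ)⟧') (by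
      rw [Preadditive.comp_sub, hg, Functor.map_comp, Category.assoc, sub_self])
    obtain ⟨a, rfl⟩ := (shiftFunctor C (1 : ℤ)).map_surjective a'
    refine ⟨_, ⟨(a, MulOpposite.op (-b)), rfl⟩, ?_⟩
    change (shiftFunctor C (1 : ℤ)).map (η ≫ a - (-b) ≫ η) = m
    rw [Preadditive.neg_comp, sub_neg_eq_add, Functor.map_add, Functor.map_comp, ← ha,
      sub_add_cancel]
  · rintro ⟨_, ⟨⟨a, b⟩, rfl⟩, rfl⟩
    change p ≫ (shiftFunctor C (1 : ℤ)).map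
      (η ≫ (a : T₀ ⟶ T₀) - (b.unop : T₁ ⟶ T₁) ≫ η) ≫ ι⟦(1 : ℤ)⟧' = 0
    have h1 : p ≫ η⟦(1 : ℤ)⟧' = 0 := comp_distTriang_mor_zero₃₁ _ hT
    have h2 : η ≫ ι = 0 := comp_distTriang_mor_zero₁₂ _ hT
    rw [← Functor.map_comp, Preadditive.sub_comp, Functor.map_sub, Preadditive.comp_sub,
      Category.assoc, Category.assoc, h2, comp_zero, Functor.map_zero, comp_zero, sub_zero,
      Functor.map_comp, ← Category.assoc, h1, zero_comp]

variable [∀ X Y : C, Module.Finite k (X ⟶ Y)]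

/-- Half the dimension of `C(Z, Σ Z)` is the codimension of the tangent space to the orbit. -/
theorem finrank_cone_hom_shift (hCY : IsTwoCalabiYau k C) (hT : Triangle.mk η ι p ∈ distTriang C)
    (h₀₀ : ∀ f : T₀ ⟶ T₀⟦(1 : ℤ)⟧, f = 0) (h₁₁ : ∀ f : T₁ ⟶ T₁⟦(1 : ℤ)⟧, f = 0)
    (h₀₁ : ∀ f : T₀ ⟶ T₁⟦(1 : ℤ)⟧, f = 0) :
    Module.finrank k (Z ⟶ Z⟦(1 : ℤ)⟧) + 2 * Module.finrank k (LinearMap.range (tangentMap k η)) =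
      2 * Module.finrank k (T₁ ⟶ T₀) := by
  have h1 := LinearMap.finrank_range_add_finrank_ker (throughShift k ι p)
  have h2 := LinearMap.finrank_range_add_finrank_ker (restrictToEnds k ι p)
  rw [← range_throughShift hT h₀₀ h₁₁, finrank_range_restrictToEnds hCY] at h2
  rw [ker_throughShift hT h₀₁, LinearEquiv.finrank_map_eq,
    ← (shiftHomEquiv k T₁ T₀).finrank_eq] at h1
  omega

theorem two_mul_zariskiCodim_autOrbit [Infinite k] (hCY : IsTwoCalabiYau k C)
    (hT : Triangle.mk η ι p ∈ distTriang C)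
    (h₀₀ : ∀ f : T₀ ⟶ T₀⟦(1 : ℤ)⟧, f = 0) (h₁₁ : ∀ f : T₁ ⟶ T₁⟦(1 : ℤ)⟧, f = 0)
    (h₀₁ : ∀ f : T₀ ⟶ T₁⟦(1 : ℤ)⟧, f = 0) :
    2 * zariskiCodim k (autOrbit η) = (Module.finrank k (Z ⟶ Z⟦(1 : ℤ)⟧) : ℕ∞) := by
  have h1 := zariskiCodim_autOrbit (k := k) η
  have h2 := finrank_cone_hom_shift hCY hT h₀₀ h₁₁ h₀₁
  have hne : zariskiCodim k (autOrbit η) ≠ ⊤ := fun h => by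
    rw [h, top_add] at h1
    exact ENat.natCast_ne_top _ h1.symm
  obtain ⟨c, hc⟩ := ENat.ne_top_iff_exists.mp hne
  rw [← hc] at h1 ⊢
  have h3 : c + Module.finrank k (LinearMap.range (tangentMap k η)) =
    Module.finrank k (T₁ ⟶ T₀) := by exact_mod_cast h1
  have h4 : 2 * c = Module.finrank k (Z ⟶ Z⟦(1 : ℤ)⟧) := by omega
  exact_mod_cast h4

end Cones

/-! ### Idempotents in finite-dimensional algebras -/

section Fitting

/-- Fitting's lemma: an element of a finite-dimensional algebra is nilpotent or has a nonzero
idempotent multiple. -/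
theorem isNilpotent_or_exists_idempotent {k R : Type*} [Field k] [Ring R] [Algebra k R]
    [Module.Finite k R] (y : R) :
    IsNilpotent y ∨ ∃ c : R, y * c ≠ 0 ∧ IsIdempotentElem (y * c) := by
  let S := Algebra.adjoin k {y}
  let y' : S := ⟨y, Algebra.self_mem_adjoin_singleton k y⟩
  have : IsMulCommutative S := Algebra.isMulCommutative_adjoin k (by simp)
  have : IsArtinianRing S := IsArtinianRing.of_finite k S
  obtain ⟨n, z, hz⟩ := IsArtinian.exists_pow_succ_smul_dvd y' (1 : S)
  simp only [smul_eq_mul, mul_one] at hz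
  have hm : ∀ m, y' ^ (n + 1) * (y' * z) ^ m = y' ^ (n + 1) := fun m => by
    induction m with
    | zero => simp
    | succ m ih =>
      calc y' ^ (n + 1) * (y' * z) ^ (m + 1) = y' ^ (n + 1) * (y' * z) ^ m * (y' * z) := by ring
        _ = y' * (y' ^ (n + 1) * z) := by rw [ih]; ring
        _ = y' ^ (n + 1) := by rw [hz]; ring
  let c : S := y' ^ n * z ^ (n + 1)
  have hc : y' * c = y' ^ (n + 1) * z ^ (n + 1) := by simp only [c]; ring
  have hidem : IsIdempotentElem (y' * c) := by
    rw [IsIdempotentElem, hc]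
    calc y' ^ (n + 1) * z ^ (n + 1) * (y' ^ (n + 1) * z ^ (n + 1))
        = y' ^ (n + 1) * (y' * z) ^ (n + 1) * z ^ (n + 1) := by ring
      _ = _ := by rw [hm]
  by_cases h0 : y' * c = 0
  · left
    refine ⟨n + 1, ?_⟩
    have : y' ^ (n + 1) = 0 := by
      calc y' ^ (n + 1) = y' ^ (n + 1) * (y' * z) ^ (n + 1) := (hm _).symm
        _ = y' ^ (n + 1) * (y' * c) := by rw [hc]; ring
        _ = 0 := by rw [h0, mul_zero]
    exact congrArg Subtype.val this
  · right
    exact ⟨c, fun h => h0 (Subtype.ext h), congrArg Subtype.val hidem⟩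

end Fitting

/-! ### The cone determines the orbit -/

section Radical

variable {C : Type*} [Category C] [Preadditive C] [HasZeroObject C] [HasShift C ℤ] [∀ n : ℤ, (shiftFunctor C n).Additive] [Pretriangulated C]
  [IsIdempotentComplete C]

/-- Morphisms between objects without common summand are radical. -/
theorem NoCommonSummand.isIso_one_add_comp (k : Type*) [Field k] [Linear k C]
    [∀ X Y : C, Module.Finite k (X ⟶ Y)] {T₀ T₁ : C} (h : NoCommonSummand T₀ T₁)
    (f : T₀ ⟶ T₁) (g : T₁ ⟶ T₀) : IsIso (𝟙 T₀ + f ≫ g) := by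
  have : Module.Finite k (End T₀) := inferInstanceAs (Module.Finite k (T₀ ⟶ T₀))
  let y : End T₀ := f ≫ g
  rcases isNilpotent_or_exists_idempotent (k := k) y with hy | ⟨c, hc0, hc⟩
  · obtain ⟨⟨a, b, hab, hba⟩, ha⟩ := hy.isUnit_one_add
    have ha' : a = 𝟙 T₀ + f ≫ g := ha
    exact ⟨b, by rw [← ha']; exact hba, by rw [← ha']; exact hab⟩
  · exfalso
    -- The idempotent factors through `T₁`, so its image is a common summand.
    have he : (y * c : End T₀) = (c : T₀ ⟶ T₀) ≫ f ≫ g := rfl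
    obtain ⟨Y, i, r, hir, hri⟩ := IsIdempotentComplete.idempotents_split T₀ (y * c : End T₀) hc
    have hY : IsZero Y := h Y (isDirectSummand_of_retract i r hir)
      (isDirectSummand_of_retract (i ≫ (c : T₀ ⟶ T₀) ≫ f) (g ≫ r) (by
        calc _ = i ≫ ((c : T₀ ⟶ T₀) ≫ f ≫ g) ≫ r := by simp only [Category.assoc]
          _ = (i ≫ r) ≫ (i ≫ r) := by rw [← he, ← hri]; simp only [Category.assoc]
          _ = 𝟙 Y := by rw [hir, Category.id_comp]))
    exact hc0 (by rw [← hri, hY.eq_of_tgt r 0, zero_comp])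

/-- For `T₀`, `T₁` without common summand, a morphism `T₁ ⟶ T₀` is determined by its cone up to
automorphisms: the map `T₀ ⟶ Z` is a minimal right approximation of the cone `Z`. -/
theorem autOrbit_eq_of_iso (k : Type*) [Field k] [Linear k C]
    [∀ X Y : C, Module.Finite k (X ⟶ Y)] {T₀ T₁ Z Z' : C} (h : NoCommonSummand T₀ T₁)
    (h₀₁ : ∀ f : T₀ ⟶ T₁⟦(1 : ℤ)⟧, f = 0) {η η' : T₁ ⟶ T₀} (hZ : IsCone η Z) (hZ' : IsCone η' Z')
    (φ : Z ≅ Z') : autOrbit η = autOrbit η' := by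
  obtain ⟨ι, p, hT⟩ := hZ
  obtain ⟨ι', p', hT'⟩ := hZ'
  obtain ⟨a, ha⟩ := exists_eq_comp_mor₂ hT' (ι ≫ φ.hom) (h₀₁ _)
  obtain ⟨a', ha'⟩ := exists_eq_comp_mor₂ hT (ι' ≫ φ.inv) (h₀₁ _)
  obtain ⟨f, hf⟩ := exists_eq_comp_mor₁ hT (a ≫ a' - 𝟙 T₀) (by
    rw [Preadditive.sub_comp, Category.assoc, ← ha', ← Category.assoc, ← ha]; simp)
  obtain ⟨f', hf'⟩ := exists_eq_comp_mor₁ hT' (a' ≫ a - 𝟙 T₀) (by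
    rw [Preadditive.sub_comp, Category.assoc, ← ha, ← Category.assoc, ← ha']; simp)
  have h1 : IsIso (a ≫ a') := by
    rw [eq_add_of_sub_eq' hf]; exact h.isIso_one_add_comp k f η
  have h2 : IsIso (a' ≫ a) := by
    rw [eq_add_of_sub_eq' hf']; exact h.isIso_one_add_comp k f' η'
  have : Mono a := mono_of_mono a a'
  have : IsSplitEpi a := ⟨⟨⟨inv (a' ≫ a) ≫ a', by simp⟩⟩⟩
  have haiso : IsIso a := isIso_of_mono_of_isSplitEpi a
  obtain ⟨(b : T₁ ⟶ T₁), (hb₁ : η ≫ a = b ≫ η'), hb₃⟩ :=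
    complete_distinguished_triangle_morphism₁ _ _ hT hT' a φ.hom ha
  let Φ : Triangle.mk η ι p ⟶ Triangle.mk η' ι' p' :=
    { hom₁ := b, hom₂ := a, hom₃ := φ.hom, comm₁ := hb₁, comm₂ := ha, comm₃ := hb₃ }
  have hbiso : IsIso b := isIso₁_of_isIso₂₃ Φ hT hT' haiso (inferInstanceAs (IsIso φ.hom))
  have hη' : η' = inv b ≫ η ≫ a := by rw [hb₁, IsIso.inv_hom_id_assoc]
  ext v
  constructor
  · rintro ⟨g₀, g₁, rfl⟩
    refine ⟨(asIso a).symm ≪≫ g₀, (asIso b).symm ≪≫ g₁, ?_⟩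
    change g₁.inv ≫ η ≫ g₀.hom = (g₁.inv ≫ b) ≫ η' ≫ inv a ≫ g₀.hom
    simp [hη']
  · rintro ⟨g₀, g₁, rfl⟩
    refine ⟨asIso a ≪≫ g₀, asIso b ≪≫ g₁, ?_⟩
    change g₁.inv ≫ η' ≫ g₀.hom = (g₁.inv ≫ inv b) ≫ η ≫ a ≫ g₀.hom
    simp [hη']

end Radical

/-! ### Direct sums of lists of objects -/

section ListSum

variable {C : Type*} [Category C] [Preadditive C] [HasZeroObject C] [HasShift C ℤ]
  [∀ n : ℤ, (shiftFunctor C n).Additive] [Pretriangulated C]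

open ZeroObject in
/-- The direct sum of a list of members of a family of objects. -/
noncomputable def listSum {n : ℕ} (U : Fin n → C) : List (Fin n) → C
  | [] => 0
  | i :: l => U i ⊞ listSum U l

theorem exists_isCone {X Y : C} (η : X ⟶ Y) : ∃ Z, IsCone η Z := by
  obtain ⟨Z, ι, p, hT⟩ := distinguished_cocone_triangle η
  exact ⟨Z, ι, p, hT⟩

end ListSum

/-! ### Finiteness of the set of cones -/

section Finiteness

variable (k : Type*) [Field k] {C : Type*} [Category C] [Preadditive C] [Linear k C]
  [∀ X Y : C, Module.Finite k (X ⟶ Y)]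

theorem finrank_hom_add_le (T : C) {X Y Z : C} (iX : X ⟶ Z) (iY : Y ⟶ Z) (rX : Z ⟶ X)
    (rY : Z ⟶ Y) (h₁ : iX ≫ rX = 𝟙 X) (h₂ : iY ≫ rY = 𝟙 Y) (h₃ : iX ≫ rY = 0)
    (h₄ : iY ≫ rX = 0) :
    Module.finrank k (T ⟶ X) + Module.finrank k (T ⟶ Y) ≤ Module.finrank k (T ⟶ Z) := by
  rw [← Module.finrank_prod]
  refine LinearMap.finrank_le_finrank_of_injective
    (f := (Linear.rightComp k T iX).coprod (Linear.rightComp k T iY)) ?_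
  rw [← LinearMap.ker_eq_bot, LinearMap.ker_eq_bot']
  rintro ⟨f, g⟩ hfg
  have hfg' : f ≫ iX + g ≫ iY = 0 := hfg
  have hf : f = 0 := by simpa [h₁, h₄] using congrArg (· ≫ rX) hfg'
  have hg : g = 0 := by simpa [h₂, h₃] using congrArg (· ≫ rY) hfg'
  rw [hf, hg]
  rfl

variable [HasZeroObject C] [HasShift C ℤ] [∀ n : ℤ, (shiftFunctor C n).Additive]
  [Pretriangulated C]

/-- The size of `X` as seen by `T`: the dimension of `C(T, X)` plus that of `C(T, Σ X)`. -/
noncomputable def homSize (T X : C) : ℕ :=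
  Module.finrank k (T ⟶ X) + Module.finrank k (T ⟶ X⟦(1 : ℤ)⟧)

theorem homSize_add_le (T : C) {X Y Z : C} (e : Z ≅ X ⊞ Y) :
    homSize k T X + homSize k T Y ≤ homSize k T Z := by
  have h1 := finrank_hom_add_le k T (biprod.inl ≫ e.inv) (biprod.inr ≫ e.inv)
    (e.hom ≫ biprod.fst) (e.hom ≫ biprod.snd) (by simp) (by simp) (by simp) (by simp)
  have h2 := finrank_hom_add_le k T ((biprod.inl ≫ e.inv)⟦(1 : ℤ)⟧')
    ((biprod.inr ≫ e.inv)⟦(1 : ℤ)⟧') ((e.hom ≫ biprod.fst)⟦(1 : ℤ)⟧')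
    ((e.hom ≫ biprod.snd)⟦(1 : ℤ)⟧') (by simp [← Functor.map_comp]) (by simp [← Functor.map_comp])
    (by simp [← Functor.map_comp]) (by simp [← Functor.map_comp])
  simp only [homSize]
  omega

/-- If `C(T, Σ X) = 0` then `X` lies in `add T`, where `C(T, -)` detects zero objects. -/
theorem IsClusterTilting.isZero_of_homSize_eq_zero {T X : C} (hT : IsClusterTilting T)
    (h : homSize k T X = 0) : IsZero X := by
  have h1 : Subsingleton (T ⟶ X) := Module.finrank_zero_iff (R := k) |>.mp (by
    simp only [homSize] at h; omega)
  have h2 : Subsingleton (T ⟶ X⟦(1 : ℤ)⟧) := Module.finrank_zero_iff (R := k) |>.mp (by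
    simp only [homSize] at h; omega)
  rw [IsZero.iff_id_eq_zero]
  exact (hT.mem_add X fun f => Subsingleton.elim _ _).hom_eq_zero (fun f => Subsingleton.elim _ _) _

theorem IsClusterTilting.homSize_pos {T X : C} (hT : IsClusterTilting T) (hX : ¬ IsZero X) :
    0 < homSize k T X :=
  Nat.pos_of_ne_zero fun h => hX (hT.isZero_of_homSize_eq_zero k h)

theorem IsClusterTilting.exists_indecomposable_summand {T : C} (hT : IsClusterTilting T) (N : ℕ) :
    ∀ Z : C, homSize k T Z ≤ N → ¬ IsZero Z →
      ∃ X Y : C, Indecomposable X ∧ Nonempty (Z ≅ X ⊞ Y) := by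
  induction N with
  | zero => exact fun Z hZ hZ' => absurd (hT.homSize_pos k hZ') (by omega)
  | succ N ih =>
    intro Z hZ hZ'
    by_cases hind : Indecomposable Z
    · exact ⟨Z, _, hind, ⟨isoBiprodZero (isZero_zero C)⟩⟩
    · simp only [Indecomposable, hZ', not_false_eq_true, true_and, not_forall, not_or] at hind
      obtain ⟨X, Y, e, hX, hY⟩ := hind
      have h1 := homSize_add_le k T e
      have h2 := hT.homSize_pos k hY
      obtain ⟨X₁, X₂, hX₁, ⟨e'⟩⟩ := ih X (by omega) hX
      exact ⟨X₁, X₂ ⊞ Y, hX₁, ⟨e ≪≫ biprod.mapIso e' (Iso.refl Y) ≪≫ biprod.associator _ _ _⟩⟩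

/-- The number of indecomposable summands of `Z` is bounded by `homSize k T Z`. -/
theorem IsClusterTilting.exists_iso_listSum {T : C} (hT : IsClusterTilting T) {n : ℕ}
    (U : Fin n → C) (hU : ∀ X : C, Indecomposable X → ∃ i, Nonempty (X ≅ U i)) (N : ℕ) :
    ∀ Z : C, homSize k T Z ≤ N →
      ∃ l : List (Fin n), l.length ≤ N ∧ Nonempty (Z ≅ listSum U l) := by
  induction N with
  | zero =>
    intro Z hZ
    exact ⟨[], le_rfl, ⟨(hT.isZero_of_homSize_eq_zero k (by omega)).iso (isZero_zero C)⟩⟩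
  | succ N ih =>
    intro Z hZ
    by_cases hZ' : IsZero Z
    · exact ⟨[], Nat.zero_le _, ⟨hZ'.iso (isZero_zero C)⟩⟩
    · obtain ⟨X, Y, hX, ⟨e⟩⟩ := hT.exists_indecomposable_summand k _ Z le_rfl hZ'
      have h1 := homSize_add_le k T e
      have h2 := hT.homSize_pos k hX.1
      obtain ⟨l, hl, ⟨e'⟩⟩ := ih Y (by omega)
      obtain ⟨i, ⟨e''⟩⟩ := hU X hX
      exact ⟨i :: l, by simpa using hl, ⟨e ≪≫ biprod.mapIso e'' e'⟩⟩

theorem IsCone.homSize_le {T T₀ T₁ Z : C} {η : T₁ ⟶ T₀} (hZ : IsCone η Z)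
    (h₀ : ∀ f : T ⟶ T₀⟦(1 : ℤ)⟧, f = 0) (h₁ : ∀ f : T ⟶ T₁⟦(1 : ℤ)⟧, f = 0) :
    homSize k T Z ≤
      Module.finrank k (T ⟶ T₀) + Module.finrank k (T ⟶ T₁⟦(1 : ℤ)⟧⟦(1 : ℤ)⟧) := by
  obtain ⟨ι, p, hT⟩ := hZ
  refine Nat.add_le_add ?_ ?_
  · refine LinearMap.finrank_le_finrank_of_surjective (f := Linear.rightComp k T ι) fun f => ?_
    obtain ⟨g, rfl⟩ := exists_eq_comp_mor₂ hT f (h₁ _)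
    exact ⟨g, rfl⟩
  · refine LinearMap.finrank_le_finrank_of_injective
      (f := Linear.rightComp k T (p⟦(1 : ℤ)⟧')) ?_
    rw [← LinearMap.ker_eq_bot, LinearMap.ker_eq_bot']
    intro f hf
    obtain ⟨g, rfl⟩ := exists_eq_comp_shift_mor₂ hT f hf
    rw [h₀ g, zero_comp]

end Finiteness

/-! ### Finiteness of the set of orbits -/

section FiniteOrbits

theorem IsClusterTilting.finite_range_autOrbit (k : Type*) [Field k] {C : Type*} [Category C]
    [Preadditive C] [Linear k C] [HasZeroObject C] [HasShift C ℤ]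
    [∀ n : ℤ, (shiftFunctor C n).Additive] [Pretriangulated C]
    [∀ X Y : C, Module.Finite k (X ⟶ Y)] [IsIdempotentComplete C] {T T₀ T₁ : C}
    (hT : IsClusterTilting T) (hfin : FinitelyManyIndecomposables C) (hT₀ : InAdd T T₀)
    (hT₁ : InAdd T T₁) (h : NoCommonSummand T₀ T₁) :
    (Set.range fun η : T₁ ⟶ T₀ => autOrbit η).Finite := by
  obtain ⟨n, U, hU⟩ := hfin
  choose Z hZ using fun η : T₁ ⟶ T₀ => exists_isCone η
  choose l hl e using fun η : T₁ ⟶ T₀ => hT.exists_iso_listSum k U hU _ (Z η)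
    ((hZ η).homSize_le k (hT₀.hom_shift_eq_zero hT.rigid) (hT₁.hom_shift_eq_zero hT.rigid))
  have hlfin : (Set.range l).Finite :=
    (List.finite_length_le (Fin n) _).subset (by rintro _ ⟨η, rfl⟩; exact hl η)
  have hfac : Function.FactorsThrough (fun η : T₁ ⟶ T₀ => autOrbit η) l := fun η η' hηη' => by
    obtain ⟨e₁⟩ := e η
    obtain ⟨e₂⟩ := e η'
    exact autOrbit_eq_of_iso k h (hT.rigid.hom_shift_eq_zero hT₀ hT₁) (hZ η) (hZ η')
      (e₁ ≪≫ eqToIso (by rw [hηη']) ≪≫ e₂.symm)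
  obtain ⟨g, hg⟩ := (Function.factorsThrough_iff _).mp hfac
  rw [hg, Set.range_comp]
  exact hlfin.image g

end FiniteOrbits

/-! ### Finite covers of a vector space -/

section DenseOrbit

/-- If a vector space is a finite union of subsets, one of them is dense. -/
theorem exists_zariskiCodim_eq_zero {k V : Type*} [Field k] [Infinite k] [AddCommGroup V]
    [Module k V] [Module.Finite k V] {𝒮 : Set (Set V)} (h𝒮 : 𝒮.Finite)
    (hcover : ∀ v, ∃ S ∈ 𝒮, v ∈ S) : ∃ S ∈ 𝒮, zariskiCodim k S = 0 := by
  by_contra! h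
  have hne : ∀ S ∈ 𝒮, ∃ f ∈ vanishing k S, f ≠ 0 := fun S hS => by
    have : vanishing k S ≠ ⊥ := fun h0 => h S hS (Ideal.height_eq_zero_iff_eq_bot.mpr h0)
    exact (Submodule.ne_bot_iff _).mp this
  choose! f hf hf0 using hne
  have hprod : ∏ S ∈ h𝒮.toFinset, f S = 0 := by
    refine MvPolynomial.funext fun t => ?_
    obtain ⟨S, hS, hvS⟩ := hcover ((Module.finBasis k V).equivFun.symm t)
    have h1 := mem_vanishing.mp (hf S hS) _ hvS
    rw [LinearEquiv.apply_symm_apply] at h1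
    rw [map_prod, map_zero]
    exact Finset.prod_eq_zero (h𝒮.mem_toFinset.mpr hS) h1
  obtain ⟨S, hS, hS0⟩ := Finset.prod_eq_zero_iff.mp hprod
  exact hf0 S (h𝒮.mem_toFinset.mp hS) hS0

end DenseOrbit

end TwoCY

theorem proposition9 {k : Type*} [Field k] [IsAlgClosed k]
    {C : Type*} [Category C] [Preadditive C] [Linear k C] [HasZeroObject C] [HasShift C ℤ]
    [∀ n : ℤ, (shiftFunctor C n).Additive] [∀ n : ℤ, (shiftFunctor C n).Linear k]
    [Pretriangulated C] [IsTriangulated C] [IsIdempotentComplete C]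
    [∀ X Y : C, Module.Finite k (X ⟶ Y)]
    (hCY : TwoCY.IsTwoCalabiYau k C)
    (T : C) (hT : TwoCY.IsClusterTilting T)
    (hfin : TwoCY.FinitelyManyIndecomposables C)
    (T₀ T₁ : C) (hT₀ : TwoCY.InAdd T T₀) (hT₁ : TwoCY.InAdd T T₁)
    (hcommon : TwoCY.NoCommonSummand T₀ T₁) :
    (∃ (η : T₁ ⟶ T₀) (Z : C), TwoCY.IsCone η Z ∧ TwoCY.IsRigid Z) ∧
    (Set.range fun η : T₁ ⟶ T₀ => TwoCY.autOrbit η).Finite ∧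
    (∀ (η : T₁ ⟶ T₀) (Z : C), TwoCY.IsCone η Z →
      2 * TwoCY.zariskiCodim k (TwoCY.autOrbit η) =
        (Module.finrank k (Z ⟶ Z⟦(1 : ℤ)⟧) : ℕ∞)) := by
  have : Infinite k := IsAlgClosed.instInfinite
  have hcodim : ∀ (η : T₁ ⟶ T₀) (Z : C), TwoCY.IsCone η Z →
      2 * TwoCY.zariskiCodim k (TwoCY.autOrbit η) =
        (Module.finrank k (Z ⟶ Z⟦(1 : ℤ)⟧) : ℕ∞) := by
    rintro η Z ⟨ι, p, h⟩
    exact TwoCY.two_mul_zariskiCodim_autOrbit hCY h (hT.rigid.hom_shift_eq_zero hT₀ hT₀)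
      (hT.rigid.hom_shift_eq_zero hT₁ hT₁) (hT.rigid.hom_shift_eq_zero hT₀ hT₁)
  have hfinite := hT.finite_range_autOrbit k hfin hT₀ hT₁ hcommon
  refine ⟨?_, hfinite, hcodim⟩
  obtain ⟨_, ⟨η, rfl⟩, hη⟩ := TwoCY.exists_zariskiCodim_eq_zero (k := k) hfinite
    fun η => ⟨_, ⟨η, rfl⟩, Iso.refl _, Iso.refl _, by simp⟩
  obtain ⟨Z, hZ⟩ := TwoCY.exists_isCone η
  refine ⟨η, Z, hZ, fun f => ?_⟩
  have h := hcodim η Z hZ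
  rw [hη, mul_zero] at h
  have h0 : Module.finrank k (Z ⟶ Z⟦(1 : ℤ)⟧) = 0 := by exact_mod_cast h.symm
  have := Module.finrank_zero_iff.mp h0
  exact Subsingleton.elim _ _
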